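/- **Theorem.** Let $x_1,\dots,x_n\in\mathbb R^d$ ($n\ge 1$) be pairwise non-parallel unit vectors and let $y_1,\dots,y_n\in\mathbb R$ satisfy $|y_i|\le B$. Consider the two-layer ReLU network with $m$ hidden units, $f_i(W,a)=\frac1{\sqrt m}\sum_{r=1}^m a_r\max\{\langle w_r,x_i\rangle,0\}$, with residual $\Delta=(f_i-y_i)_{i\le n}$ and loss $L(W,a)=\frac12\sum_{i=1}^n (f_i(W,a)-y_i)^2$. With the conventions $\frac{\partial f_i}{\partial w_r}=\frac1{\sqrt m}a_r x_i\mathbb 1\{\langle w_r,x_i\rangle\ge 0\}$ and $\frac{\partial L}{\partial w_r}=\sum_i (f_i-y_i)\frac{\partial f_i}{\partial w_r}$, let $H_{ij}=\sum_{r}\langle \frac{\partial f_i}{\partial w_r},\frac{\partial f_j}{\partial w_r}\rangle$ and $\hat L=\frac12\Delta^\top H\Delta$. Let $H^\infty_{ij}=\mathbb E_{w\sim\mathcal N(0,I_d)}\big[\langle x_i,x_j\rangle\mathbb 1\{\langle w,x_i\rangle\ge0,\langle w,x_j\rangle\ge0\}\big]$, $\lambda_0=\lambda_{\min}(H^\infty)$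 and $\lambda_m=\lambda_{\max}(H^\infty)+\lambda_0/4$. For $0<s\le 2/\lambda_m$ consider the high-resolution ODE of Nesterov's method with zero initial velocity, $$\ddot w_r+\sqrt{2\lambda_0}\,\dot w_r+\sqrt s\,K_r(W,\dot W)+\Big(1+\sqrt{\tfrac{\lambda_0 s}{2}}\Big)\frac{\partial L}{\partial w_r}=0,\qquad \dot w_r(0)=0,\qquad r=1,\dots,m,$$ for fixed $a$, whose solutions are understood in the sense of Carathéodory. Here the gradient-correction term is either the diagonal-block one, $K_r=\frac{\partial^2L}{\partial w_r^2}\dot w_r=\sum_i\langle\frac{\partial f_i}{\partial w_r},\dot w_r\rangle\frac{\partial f_i}{\partial w_r}$, or the full one, $K_r=\sum_l\frac{\partial^2L}{\partial w_r\partial w_l}\dot w_l=\sum_i\big(\sum_l\langle\frac{\partial f_i}{\partial w_l},\dot w_l\rangle\big)\frac{\partial f_i}{\partial w_r}$ (the second derivatives of the $f_i$, which vanish almost everywhere, are dropped); the claim holds for both. For every $B$ there is a constant $C>0$, depending only on $B$, such that for all such data, all $\delta\in(0,1)$, all $m\ge C\,\frac{n^6}{\delta^3\lambda_0^4}$ and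 all $0<s\le 2/\lambda_m$ the following holds. If $w_r(0)\sim\mathcal N(0,I_d)$ and $a_r\sim\mathrm{unif}\{-1,1\}$, $r=1,\dots,m$, are all independent, then with probability at least $1-\delta$ every solution $W$ on an interval $[0,T]$ started at $W(0)$ satisfies, for all $t\in[0,T]$, $$L(t)\le\frac{26\,\hat L(0)}{3\lambda_0}\,e^{-\rho^*_{NAG}(\alpha)\sqrt{\lambda_0/2}\;t},\qquad \rho^*_{NAG}(\alpha)=\tfrac12\Big(4+3\alpha-\sqrt{8+16\alpha+\alpha^2}\Big),\quad \alpha=\frac{\sqrt{2\lambda_0s}}4 .$$ Moreover, $\rho^*_{NAG}(\alpha)>2-\sqrt2$ for all $0<\alpha\le\frac12$, i.e. the exponent exceeds the heavy-ball exponent $2-\sqrt2$. -/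

import Mathlib

open MeasureTheory ProbabilityTheory
open scoped ENNReal

noncomputable section

namespace ReLUNet

/-- Input space `ℝ^d` with the Euclidean norm. -/
abbrev Vec (d : ℕ) : Type := EuclideanSpace ℝ (Fin d)

/-- Hidden-layer weights `w_1, …, w_m ∈ ℝ^d`. -/
abbrev Weights (m d : ℕ) : Type := Fin m → Vec d

/-! ### The network, its loss and its formal derivatives -/

section Network

variable {n d m : ℕ}

/-- Two-layer ReLU network `f(W, a, z) = m^{-1/2} ∑_r a_r max(⟨w_r, z⟩, 0)`. -/
def net (a : Fin m → ℝ) (w : Weights m d) (z : Vec d) : ℝ :=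
  (1 / √(m : ℝ)) * ∑ r, a r * max (inner ℝ (w r) z) 0

/-- Residual vector `Δ = f - y`. -/
def residual (x : Fin n → Vec d) (y : Fin n → ℝ) (a : Fin m → ℝ) (w : Weights m d) :
    Fin n → ℝ :=
  fun i => net a w (x i) - y i

/-- Square loss `L(W, a) = ½ ∑_i (f(W, a, x_i) - y_i)²`. -/
def loss (x : Fin n → Vec d) (y : Fin n → ℝ) (a : Fin m → ℝ) (w : Weights m d) : ℝ :=
  (1 / 2) * ∑ i, residual x y a w i ^ 2

/-- `∂f_i/∂w_r = m^{-1/2} a_r 𝟙{⟨w_r, x_i⟩ ≥ 0} x_i`. -/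
def outGrad (x : Fin n → Vec d) (a : Fin m → ℝ) (w : Weights m d) (i : Fin n) (r : Fin m) :
    Vec d :=
  if 0 ≤ inner ℝ (w r) (x i) then (a r / √(m : ℝ)) • x i else 0

/-- `∂L/∂w_r = ∑_i (f_i - y_i) ∂f_i/∂w_r`. -/
def lossGrad (x : Fin n → Vec d) (y : Fin n → ℝ) (a : Fin m → ℝ) (w : Weights m d)
    (r : Fin m) : Vec d :=
  ∑ i, residual x y a w i • outGrad x a w i r

/-- The diagonal block of the (almost everywhere) Hessian of `L` applied to a velocity:
`(∂²L/∂w_r²) v_r = ∑_i ⟨∂f_i/∂w_r, v_r⟩ ∂f_i/∂w_r`. -/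
def hessBlock (x : Fin n → Vec d) (a : Fin m → ℝ) (w v : Weights m d) (r : Fin m) : Vec d :=
  ∑ i, (inner ℝ (outGrad x a w i r) (v r) : ℝ) • outGrad x a w i r

/-- The full (almost everywhere) Hessian of `L` applied to a velocity, `r`-th component:
`∑_l (∂²L/∂w_r∂w_l) v_l = ∑_i (∑_l ⟨∂f_i/∂w_l, v_l⟩) ∂f_i/∂w_r`. -/
def hessFull (x : Fin n → Vec d) (a : Fin m → ℝ) (w v : Weights m d) (r : Fin m) : Vec d :=
  ∑ i, (∑ l, (inner ℝ (outGrad x a w i l) (v l) : ℝ)) • outGrad x a w i r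

/-- Gram matrix `H_ij = ∑_r ⟨∂f_i/∂w_r, ∂f_j/∂w_r⟩`. -/
def gram (x : Fin n → Vec d) (a : Fin m → ℝ) (w : Weights m d) : Matrix (Fin n) (Fin n) ℝ :=
  Matrix.of fun i j => ∑ r, (inner ℝ (outGrad x a w i r) (outGrad x a w j r) : ℝ)

/-- Pseudo-loss `L̂ = ½ Δᵀ H Δ`. -/
def pseudoLoss (x : Fin n → Vec d) (y : Fin n → ℝ) (a : Fin m → ℝ) (w : Weights m d) : ℝ :=
  (1 / 2) * ∑ i, ∑ j, residual x y a w i * gram x a w i j * residual x y a w j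

/-- Limiting neural tangent kernel matrix
`H^∞_ij = E_{w ∼ N(0, I)} [⟨x_i, x_j⟩ 𝟙{⟨w, x_i⟩ ≥ 0, ⟨w, x_j⟩ ≥ 0}]`. -/
def gramInf (x : Fin n → Vec d) : Matrix (Fin n) (Fin n) ℝ :=
  Matrix.of fun i j =>
    ∫ w : Vec d, (if 0 ≤ inner ℝ w (x i) ∧ 0 ≤ inner ℝ w (x j) then (inner ℝ (x i) (x j) : ℝ)
      else 0) ∂(stdGaussian (Vec d))

/-- `λ_0`, the smallest eigenvalue of `H^∞`. -/
def lam0 (x : Fin n → Vec d) : ℝ := sInf (spectrum ℝ (gramInf x))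

/-- `λ_m = λ_max(H^∞) + λ_0 / 4`. -/
def lamM (x : Fin n → Vec d) : ℝ := sSup (spectrum ℝ (gramInf x)) + lam0 x / 4

/-! ### The high-resolution NAG dynamics -/

/-- `(W, V)` is a (Carathéodory) solution on `[0, T]`, with zero initial velocity, of
`ẅ_r + √(2λ₀) ẇ_r + √s K(W, Ẇ)_r + (1 + √(λ₀ s / 2)) ∂L/∂w_r = 0`, `r = 1, …, m`,
where `V = Ẇ` and `K(W, Ẇ)` is the curvature (gradient correction) term: `W` is differentiable
with derivative `V`, and `V` is the integral of the acceleration given by the equation. -/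
structure IsNAGSolution (x : Fin n → Vec d) (y : Fin n → ℝ) (a : Fin m → ℝ)
    (K : Weights m d → Weights m d → Weights m d) (s T : ℝ) (W V : ℝ → Weights m d) : Prop where
  hasDeriv : ∀ t ∈ Set.Icc 0 T, ∀ r,
    HasDerivWithinAt (fun τ => W τ r) (V t r) (Set.Icc 0 T) t
  init_velocity : V 0 = 0
  integrable : ∀ t ∈ Set.Icc 0 T, ∀ r, IntervalIntegrable
    (fun τ => -(√(2 * lam0 x) • V τ r + √s • K (W τ) (V τ) r
      + (1 + √(lam0 x * s / 2)) • lossGrad x y a (W τ) r)) volume 0 t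
  velocity : ∀ t ∈ Set.Icc 0 T, ∀ r, V t r = V 0 r + ∫ τ in (0 : ℝ)..t,
    -(√(2 * lam0 x) • V τ r + √s • K (W τ) (V τ) r
      + (1 + √(lam0 x * s / 2)) • lossGrad x y a (W τ) r)

/-- `α = √(2 λ₀ s) / 4`. -/
def nagAlpha (x : Fin n → Vec d) (s : ℝ) : ℝ := √(2 * lam0 x * s) / 4

end Network

/-- `ρ*_NAG(α) = ½ (4 + 3α - √(8 + 16α + α²))`. -/
def rhoNAG (α : ℝ) : ℝ := (1 / 2) * (4 + 3 * α - √(8 + 16 * α + α ^ 2))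

/-! ### The random initialization -/

/-- The uniform distribution on `{-1, 1}`. -/
def signLaw : Measure ℝ :=
  (2⁻¹ : ℝ≥0∞) • Measure.dirac (-1) + (2⁻¹ : ℝ≥0∞) • Measure.dirac 1

instance : IsProbabilityMeasure signLaw where
  measure_univ := by simp [signLaw, ENNReal.inv_two_add_inv_two]

/-- Law of the initialization `((w_r(0))_r, (a_r)_r)`: all independent,
`w_r(0) ∼ N(0, I_d)` and `a_r` uniform on `{-1, 1}`. -/
def initLaw (m d : ℕ) : Measure (Weights m d × (Fin m → ℝ)) :=
  (Measure.pi fun _ : Fin m => stdGaussian (Vec d)).prod (Measure.pi fun _ : Fin m => signLaw)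

instance (m d : ℕ) : IsProbabilityMeasure (initLaw m d) := by
  unfold initLaw; infer_instance

end ReLUNet

end

/-!
The proof follows the residual `Δ` and the velocity `V`, both with Euclidean norms. Write `J` for the
Jacobian of the outputs and `γ = √(λ₀/2)`, `σ = √s`, `b = 1 + γσ`. Almost everywhere in time

  `Δ' = J V`,   `V' = -2γ V - Jᵀ(κ σ J V + b Δ) + e`,

with `κ = 1`, `e = 0` for the full gradient correction; for the diagonal-block correction `κ = 0` and
the correction itself, of relative size `n / m`, is the error `e` (`exists_curvature_split`).

*Energy.* Let `J₀` be the Jacobian at the initialization and `A = (J₀ J₀ᵀ)⁻¹ J₀`, so that `A J₀ᵀ = 1`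
and `γ‖A v‖ ≤ 3/4 ‖v‖`. The energy `½‖V‖² + (b/2)‖Δ‖² + γ⟪A V, Δ⟫` is comparable to
`‖V‖² + ‖Δ‖²`, uniformly in the condition number of the kernel, because the cross term measures `V`
through the pseudo-inverse. It decays at rate `3γ/4` as long as `A Jᵀ` is close to `1`
(`energy_deriv_le`). The exponent claimed is no larger, since `ρ*(α) ≤ 3/4` for `α ≤ 1/2`
(`rhoNAG_le`) and `s ≤ 2/λ_m` gives `α ≤ 1/2`; the prefactor exceeds `5 L(0)` because
`J₀ J₀ᵀ ≥ (9/10) λ₀`.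

*Regularity.* The outputs are only absolutely continuous in time, with the formal derivative almost
everywhere (`hasDerivAt_max_zero`); Gronwall's inequality for absolutely continuous functions
(`le_mul_exp_of_ae_deriv_le`) is all that is needed, so activation changes cause no jump terms.

*Lazy training.* If no neuron moves by more than `R`, only neurons that start within `R` of an
activation boundary change `J`, and `J₀ (J - J₀)ᵀ` is bounded by their number
(`norm_jac_jacT_sub_le`). Exponential decay bounds the travel of every neuron by less than `R`
(`norm_travel_le`), which closes the argument (`GoodInit.loss_le`).

*Initialization.* Second moments and Markov's inequality show that a width `m ≥ C n⁶/(δ³ λ₀⁴)` provides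
all conditions with probability `1 - δ` (`exists_good_event`, `goodInit_of_width`). Positivity of `λ₀`
holds because across a boundary point of `x_i` lying on no other boundary exactly one activation
jumps (`integral_norm_sq_feature_pos`).
-/

namespace ReLUNet

/-! ### The energy estimate in an abstract inner product space -/

section Energy

variable {F X : Type*} [NormedAddCommGroup F] [InnerProductSpace ℝ F]
  [NormedAddCommGroup X] [InnerProductSpace ℝ X]

/-- If `J Jᵀ ≥ μ > 0`, then `N = (J Jᵀ)⁻¹` satisfies `‖N‖ ≤ μ⁻¹`, and `N J` is the transpose of
the pseudo-inverse of `J`: its norm is at most `μ^{-1/2}`, and `⟪N J v, J v⟫` is the squared length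
of the projection of `v` to the range of `Jᵀ`. -/
lemma exists_gram_inverse [FiniteDimensional ℝ X] (J : F →ₗ[ℝ] X) (Jt : X →ₗ[ℝ] F)
    (hadj : ∀ u v, inner ℝ (Jt u) v = inner ℝ u (J v)) {μ : ℝ} (hμ : 0 < μ)
    (hJ : ∀ u, μ * ‖u‖ ^ 2 ≤ ‖Jt u‖ ^ 2) :
    ∃ N : X →ₗ[ℝ] X, (∀ u, N (J (Jt u)) = u) ∧ (∀ u, μ * ‖N u‖ ≤ ‖u‖) ∧
      (∀ v, μ * ‖N (J v)‖ ^ 2 ≤ ‖v‖ ^ 2) ∧ (∀ v, inner ℝ (N (J v)) (J v) ≤ ‖v‖ ^ 2) := by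
  have hH : ∀ u, inner ℝ u (J (Jt u)) = ‖Jt u‖ ^ 2 := fun u => by
    rw [← hadj, real_inner_self_eq_norm_sq]
  have hinj : Function.Injective (J ∘ₗ Jt) := by
    refine (injective_iff_map_eq_zero _).2 fun u hu => ?_
    have h1 := hH u
    have h2 := hJ u
    rw [show J (Jt u) = 0 from hu, inner_zero_right] at h1
    have h3 : ‖u‖ ^ 2 ≤ 0 := by nlinarith
    simpa using le_antisymm h3 (sq_nonneg _)
  let e := LinearEquiv.ofInjectiveEndo (J ∘ₗ Jt) hinj
  have he : ∀ u, J (Jt (e.symm u)) = u := fun u => e.apply_symm_apply u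
  have hp : ∀ v, ‖Jt (e.symm (J v))‖ ≤ ‖v‖ := fun v => by
    have h1 := hH (e.symm (J v))
    rw [he, ← hadj] at h1
    have h2 := real_inner_le_norm (Jt (e.symm (J v))) v
    by_contra hlt
    push Not at hlt
    nlinarith [norm_nonneg v]
  refine ⟨e.symm.toLinearMap, fun u => e.symm_apply_apply u, fun u => ?_, fun v => ?_, fun v => ?_⟩
  · have h1 := hH (e.symm u)
    rw [he] at h1
    have h2 := real_inner_le_norm (e.symm u) u
    have h3 := hJ (e.symm u)
    change μ * ‖e.symm u‖ ≤ ‖u‖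
    by_contra hlt
    push Not at hlt
    have h4 : 0 < ‖e.symm u‖ := by
      by_contra h0
      have h5 : ‖e.symm u‖ = 0 := le_antisymm (not_lt.1 h0) (norm_nonneg _)
      rw [h5] at hlt
      linarith [norm_nonneg u]
    nlinarith
  · exact (hJ _).trans (pow_le_pow_left₀ (norm_nonneg _) (hp v) 2)
  · have h1 := hH (e.symm (J v))
    rw [he] at h1
    exact h1.trans_le (pow_le_pow_left₀ (norm_nonneg _) (hp v) 2)

/-- The energy `½‖v‖² + (b/2)‖z‖² + γ ⟪A v, z⟫` of velocity `v` and residual `z`; `A` plays the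
role of the transposed pseudo-inverse of the Jacobian at initialization. -/
noncomputable def energy (A : F →ₗ[ℝ] X) (γ b : ℝ) (v : F) (z : X) : ℝ :=
  1 / 2 * ‖v‖ ^ 2 + b / 2 * ‖z‖ ^ 2 + γ * inner ℝ (A v) z

lemma abs_cross_le {A : F →ₗ[ℝ] X} {γ : ℝ} (hγ : 0 ≤ γ) {v : F} (z : X)
    (hA : γ * ‖A v‖ ≤ 3 / 4 * ‖v‖) :
    |γ * inner ℝ (A v) z| ≤ 3 / 4 * (‖v‖ * ‖z‖) := by
  rw [abs_mul, abs_of_nonneg hγ]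
  calc γ * |inner ℝ (A v) z| ≤ γ * (‖A v‖ * ‖z‖) := by gcongr; exact abs_real_inner_le_norm _ _
    _ = γ * ‖A v‖ * ‖z‖ := by ring
    _ ≤ 3 / 4 * ‖v‖ * ‖z‖ := by gcongr
    _ = _ := by ring

lemma energy_lower {A : F →ₗ[ℝ] X} {γ b : ℝ} (hγ : 0 ≤ γ) (hb : 1 ≤ b) {v : F} (z : X)
    (hA : γ * ‖A v‖ ≤ 3 / 4 * ‖v‖) :
    ‖v‖ ^ 2 ≤ 5 * energy A γ b v z ∧ ‖z‖ ^ 2 ≤ 5 * energy A γ b v z := by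
  have h := abs_le.1 (abs_cross_le hγ z hA)
  have hz : 0 ≤ (b - 1) * ‖z‖ ^ 2 := mul_nonneg (by linarith) (sq_nonneg _)
  unfold energy
  constructor
  · nlinarith [sq_nonneg (3 / 4 * ‖v‖ - ‖z‖)]
  · nlinarith [sq_nonneg (‖v‖ - 3 / 4 * ‖z‖)]

/-- Decay of the energy at rate `3γ/4` along
`v' = -2γ v - Jᵀ(κ σ J v + b z) + e`, `z' = J v`, when `A` is an approximate left inverse of `Jᵀ`
and the error `e` is small compared with the friction. The case `κ = 1` is the full gradient
correction, whose dissipation `σ‖J v‖²` absorbs the matching term of the cross derivative; `κ = 0`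
is used for the diagonal-block correction, which is treated as part of `e`. -/
lemma energy_deriv_le {A J : F →ₗ[ℝ] X} {Jt : X →ₗ[ℝ] F} {γ σ κ b : ℝ} {v e : F} {z : X}
    (hadj : ∀ u v, inner ℝ (Jt u) v = inner ℝ u (J v))
    (hγ : 0 < γ) (hσ : 0 ≤ σ) (hκ : κ = 0 ∨ κ = 1) (hb : b = 1 + γ * σ)
    (hA : ∀ v, γ * ‖A v‖ ≤ 3 / 4 * ‖v‖)
    (hAJ : inner ℝ (A v) (J v) ≤ 21 / 20 * ‖v‖ ^ 2)
    (hAJt : ∀ u, ‖A (Jt u) - u‖ ≤ 1 / 20 * ‖u‖)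
    (he : ‖e‖ ≤ 1 / 20 * (γ * ‖v‖))
    {v' : F} (hv' : v' = -(2 * γ) • v - Jt ((κ * σ) • J v + b • z) + e) :
    inner ℝ v v' + b * inner ℝ z (J v) + γ * (inner ℝ (A v') z + inner ℝ (A v) (J v)) ≤
      -(3 / 4 * γ) * energy A γ b v z := by
  set u := (κ * σ) • J v + b • z with hu
  have hκ0 : 0 ≤ κ := by rcases hκ with h | h <;> simp [h]
  have hb1 : 1 ≤ b := by rw [hb]; nlinarith [mul_nonneg hγ.le hσ]
  have h1 : inner ℝ v v' = -(2 * γ) * ‖v‖ ^ 2 - (κ * σ) * ‖J v‖ ^ 2 - b * inner ℝ z (J v)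
      + inner ℝ v e := by
    rw [hv', inner_add_right, inner_sub_right, inner_smul_right, real_inner_self_eq_norm_sq,
      real_inner_comm (Jt u) v, hadj, hu, inner_add_left, inner_smul_left, inner_smul_left,
      real_inner_self_eq_norm_sq]
    simp only [conj_trivial]
    ring
  have h2 : inner ℝ (A v') z = -2 * (γ * inner ℝ (A v) z) - inner ℝ (A (Jt u) - u) z
      - κ * σ * inner ℝ (J v) z - b * ‖z‖ ^ 2 + inner ℝ (A e) z := by
    rw [hv', map_add, map_sub, map_smul, inner_add_left, inner_sub_left, inner_smul_left,
      inner_sub_left, ← real_inner_self_eq_norm_sq]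
    have : inner ℝ u z = κ * σ * inner ℝ (J v) z + b * inner ℝ z z := by
      rw [hu, inner_add_left, inner_smul_left, inner_smul_left]; simp
    rw [this]
    simp only [conj_trivial]
    ring
  have hve : inner ℝ v e ≤ 1 / 20 * γ * ‖v‖ ^ 2 := by
    calc inner ℝ v e ≤ ‖v‖ * ‖e‖ := real_inner_le_norm _ _
      _ ≤ ‖v‖ * (1 / 20 * (γ * ‖v‖)) := by gcongr
      _ = _ := by ring
  have hQ := abs_le.1 (abs_cross_le hγ.le z (hA v))
  have hAe : γ * inner ℝ (A e) z ≤ 3 / 80 * γ * (‖v‖ * ‖z‖) := by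
    have := (abs_le.1 (abs_cross_le hγ.le z (hA e))).2
    calc _ ≤ 3 / 4 * (‖e‖ * ‖z‖) := this
      _ ≤ 3 / 4 * (1 / 20 * (γ * ‖v‖) * ‖z‖) := by gcongr
      _ = _ := by ring
  have hunorm : ‖u‖ ≤ κ * σ * ‖J v‖ + b * ‖z‖ := by
    refine (norm_add_le _ _).trans ?_
    rw [norm_smul, norm_smul, Real.norm_of_nonneg (by positivity), Real.norm_of_nonneg (by linarith)]
  have hE : -inner ℝ (A (Jt u) - u) z ≤ 1 / 20 * (κ * σ * ‖J v‖ + b * ‖z‖) * ‖z‖ := by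
    have h3 := (abs_le.1 (abs_real_inner_le_norm (A (Jt u) - u) z)).1
    calc _ ≤ ‖A (Jt u) - u‖ * ‖z‖ := by linarith
      _ ≤ 1 / 20 * ‖u‖ * ‖z‖ := by gcongr; exact hAJt u
      _ ≤ _ := by gcongr
  have hJz : -(κ * σ * inner ℝ (J v) z) ≤ κ * σ * (‖J v‖ * ‖z‖) := by
    have := (abs_le.1 (abs_real_inner_le_norm (J v) z)).1
    nlinarith [mul_nonneg hκ0 hσ]
  -- Young's inequality: the gradient-correction part of the cross derivative is absorbed by the
  -- dissipation `κ σ ‖J v‖²` and by the part `κ γ σ ‖z‖²` of `b ‖z‖²`.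
  have hyoung : γ * (21 / 20 * (κ * σ) * (‖J v‖ * ‖z‖)) ≤
      κ * σ * ‖J v‖ ^ 2 + 1 / 2 * γ * (γ * σ) * ‖z‖ ^ 2 := by
    have h3 : 0 ≤ κ * σ * (‖J v‖ - 21 / 40 * γ * ‖z‖) ^ 2 := by positivity
    have h4 : κ * (γ * (γ * σ) * ‖z‖ ^ 2) ≤ 1 * (γ * (γ * σ) * ‖z‖ ^ 2) :=
      mul_le_mul_of_nonneg_right (by rcases hκ with h | h <;> simp [h]) (by positivity)
    have h5 : 0 ≤ κ * (γ * (γ * σ) * ‖z‖ ^ 2) := by positivity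
    nlinarith
  have hfin : γ * (-(21 / 40) * ‖v‖ ^ 2 + 39 / 40 * (‖v‖ * ‖z‖) - 23 / 40 * ‖z‖ ^ 2) ≤ 0 := by
    refine mul_nonpos_of_nonneg_of_nonpos hγ.le ?_
    nlinarith [sq_nonneg (‖v‖ - ‖z‖)]
  have hE' := mul_le_mul_of_nonneg_left hE hγ.le
  have hJz' := mul_le_mul_of_nonneg_left hJz hγ.le
  have hAJ' := mul_le_mul_of_nonneg_left hAJ hγ.le
  have hQ' := mul_le_mul_of_nonneg_left hQ.1 hγ.le
  have hzz : 0 ≤ γ * (γ * σ) * ‖z‖ ^ 2 := by positivity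
  rw [h1, h2]
  unfold energy
  subst hb
  nlinarith

lemma hasDerivAt_energy [FiniteDimensional ℝ F] (A : F →ₗ[ℝ] X) (γ b : ℝ) {v : ℝ → F}
    {z : ℝ → X} {v' : F} {z' : X} {t : ℝ} (hv : HasDerivAt v v' t) (hz : HasDerivAt z z' t) :
    HasDerivAt (fun τ => energy A γ b (v τ) (z τ))
      (inner ℝ (v t) v' + b * inner ℝ (z t) z'
        + γ * (inner ℝ (A v') (z t) + inner ℝ (A (v t)) z')) t := by
  have hA : HasDerivAt (fun τ => A (v τ)) (A v') t :=
    A.toContinuousLinearMap.hasFDerivAt.comp_hasDerivAt t hv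
  unfold energy
  refine (((hv.norm_sq.const_mul (1 / 2)).fun_add (hz.norm_sq.const_mul (b / 2))).fun_add
    ((hA.inner ℝ hz).const_mul γ)).congr_deriv ?_
  ring

end Energy

/-! ### Absolutely continuous curves -/

section AbsolutelyContinuous

variable {E E' : Type*} [NormedAddCommGroup E] [InnerProductSpace ℝ E] [NormedAddCommGroup E']
  [InnerProductSpace ℝ E'] {a b : ℝ}

lemma absolutelyContinuousOnInterval_congr {X : Type*} [PseudoMetricSpace X] {f g : ℝ → X}
    (hf : AbsolutelyContinuousOnInterval f a b) (h : Set.EqOn f g (Set.uIcc a b)) :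
    AbsolutelyContinuousOnInterval g a b := by
  rw [absolutelyContinuousOnInterval_iff] at hf ⊢
  intro ε hε
  obtain ⟨δ, hδ, H⟩ := hf ε hε
  refine ⟨δ, hδ, fun I hI hlt => ?_⟩
  have := H I hI hlt
  rwa [Finset.sum_congr rfl fun i hi => by
    rw [h (hI.1 i hi).1, h (hI.1 i hi).2]] at this

lemma absolutelyContinuousOnInterval_comp_lipschitz {f : ℝ → ℝ} {g : ℝ → ℝ}
    (hf : AbsolutelyContinuousOnInterval f a b) (hg : LipschitzWith 1 g) :
    AbsolutelyContinuousOnInterval (fun t => g (f t)) a b := by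
  rw [absolutelyContinuousOnInterval_iff] at hf ⊢
  intro ε hε
  obtain ⟨δ, hδ, H⟩ := hf ε hε
  refine ⟨δ, hδ, fun I hI hlt => (Finset.sum_le_sum fun i _ => ?_).trans_lt (H I hI hlt)⟩
  simpa using hg.dist_le_mul (f (I.2 i).1) (f (I.2 i).2)

lemma absolutelyContinuousOnInterval_const {X : Type*} [PseudoMetricSpace X] (c : X) :
    AbsolutelyContinuousOnInterval (fun _ => c) a b :=
  ((LipschitzWith.const c).lipschitzOnWith (s := Set.uIcc a b)).absolutelyContinuousOnInterval

lemma absolutelyContinuousOnInterval_sum {ι : Type*} (s : Finset ι) {f : ι → ℝ → ℝ}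
    (hf : ∀ i ∈ s, AbsolutelyContinuousOnInterval (f i) a b) :
    AbsolutelyContinuousOnInterval (fun t => ∑ i ∈ s, f i t) a b := by
  classical
  induction s using Finset.induction_on with
  | empty => simpa using absolutelyContinuousOnInterval_const 0
  | insert i s hi ih =>
    simp only [Finset.sum_insert hi]
    exact (hf i (Finset.mem_insert_self i s)).fun_add
      (ih fun j hj => hf j (Finset.mem_insert_of_mem hj))

/-- Curves all of whose scalar products with fixed vectors are absolutely continuous have an
absolutely continuous scalar product. -/
lemma absolutelyContinuousOnInterval_inner [FiniteDimensional ℝ E] {f g : ℝ → E}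
    (hf : ∀ e, AbsolutelyContinuousOnInterval (fun t => inner ℝ e (f t)) a b)
    (hg : ∀ e, AbsolutelyContinuousOnInterval (fun t => inner ℝ e (g t)) a b) :
    AbsolutelyContinuousOnInterval (fun t => (inner ℝ (f t) (g t) : ℝ)) a b := by
  have h := absolutelyContinuousOnInterval_sum Finset.univ fun i _ =>
    (hf (stdOrthonormalBasis ℝ E i)).fun_mul (hg (stdOrthonormalBasis ℝ E i))
  refine absolutelyContinuousOnInterval_congr h fun t _ => ?_
  rw [← (stdOrthonormalBasis ℝ E).sum_inner_mul_inner (f t) (g t)]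
  exact Finset.sum_congr rfl fun i _ => by rw [real_inner_comm (f t)]

lemma absolutelyContinuousOnInterval_integral [CompleteSpace E] {f : ℝ → E}
    (hf : IntervalIntegrable f volume a b) (c e : E) :
    AbsolutelyContinuousOnInterval (fun t => (inner ℝ e (c + ∫ τ in a..t, f τ) : ℝ)) a b := by
  have hfe : IntervalIntegrable (fun τ => (inner ℝ e (f τ) : ℝ)) volume a b :=
    ⟨(innerSL ℝ e).integrable_comp hf.1, (innerSL ℝ e).integrable_comp hf.2⟩
  refine absolutelyContinuousOnInterval_congr
    ((absolutelyContinuousOnInterval_const (inner ℝ e c)).fun_add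
      (hfe.absolutelyContinuousOnInterval_intervalIntegral Set.left_mem_uIcc)) fun t ht => ?_
  have hft : IntervalIntegrable f volume a t :=
    hf.mono_set (Set.uIcc_subset_uIcc Set.left_mem_uIcc ht)
  have := (innerSL ℝ e).intervalIntegral_comp_comm hft
  simp only [innerSL_apply_apply] at this
  simp only [this, inner_add_right]

lemma absolutelyContinuousOnInterval_energy [FiniteDimensional ℝ E] [FiniteDimensional ℝ E']
    (A : E →ₗ[ℝ] E') (γ c : ℝ) {v : ℝ → E} {z : ℝ → E'}
    (hv : ∀ e, AbsolutelyContinuousOnInterval (fun t => inner ℝ e (v t)) a b)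
    (hz : ∀ e, AbsolutelyContinuousOnInterval (fun t => inner ℝ e (z t)) a b) :
    AbsolutelyContinuousOnInterval (fun t => energy A γ c (v t) (z t)) a b := by
  have hAv : ∀ e, AbsolutelyContinuousOnInterval (fun t => inner ℝ e (A (v t))) a b := fun e => by
    simpa only [LinearMap.adjoint_inner_left] using hv (LinearMap.adjoint A e)
  have h1 := (absolutelyContinuousOnInterval_inner hv hv).const_mul (1 / 2)
  have h2 := (absolutelyContinuousOnInterval_inner hz hz).const_mul (c / 2)
  have h3 := (absolutelyContinuousOnInterval_inner hAv hz).const_mul γ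
  unfold energy
  simp only [← real_inner_self_eq_norm_sq]
  exact (h1.fun_add h2).fun_add h3

/-- Gronwall's inequality for an absolutely continuous function. -/
lemma le_mul_exp_of_ae_deriv_le {f : ℝ → ℝ} {T c : ℝ} (hT : 0 ≤ T)
    (hf : AbsolutelyContinuousOnInterval f 0 T)
    (h : ∀ᵐ t, t ∈ Set.Ioo 0 T → ∃ f', HasDerivAt f f' t ∧ f' ≤ -c * f t) :
    f T ≤ f 0 * Real.exp (-(c * T)) := by
  have hexp : AbsolutelyContinuousOnInterval (fun t => Real.exp (c * t)) 0 T := by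
    refine ContDiffOn.absolutelyContinuousOnInterval (ContDiff.contDiffOn ?_)
    fun_prop
  have hg := hexp.fun_mul hf
  have hle : ∫ t in (0 : ℝ)..T, deriv (fun t => Real.exp (c * t) * f t) t ≤ 0 := by
    rw [intervalIntegral.integral_of_le hT, ← integral_Ioc_eq_integral_Ioo.symm]
    refine integral_nonpos_of_ae ?_
    rw [Filter.EventuallyLE, ae_restrict_iff' measurableSet_Ioo]
    filter_upwards [h] with t ht htT
    obtain ⟨f', hf', hle⟩ := ht htT
    have hd : HasDerivAt (fun t => Real.exp (c * t)) (Real.exp (c * t) * c) t := by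
      simpa using ((hasDerivAt_id t).const_mul c).exp
    rw [(hd.fun_mul hf').deriv]
    have := mul_le_mul_of_nonneg_left hle (Real.exp_pos (c * t)).le
    simp only [Pi.zero_apply]
    linarith
  rw [hg.integral_deriv_eq_sub] at hle
  simp only [mul_zero, Real.exp_zero, one_mul, sub_nonpos] at hle
  rw [Real.exp_neg, ← div_eq_mul_inv, le_div_iff₀ (Real.exp_pos _)]
  linarith

/-- Wherever `max u 0` is differentiable, its derivative is `u' 𝟙{u ≥ 0}`: at a zero of `u` both
`max u 0` and `max u 0 - u` have a minimum. -/
lemma hasDerivAt_max_zero {u : ℝ → ℝ} {u' t : ℝ} (hu : HasDerivAt u u' t)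
    (hd : DifferentiableAt ℝ (fun τ => max (u τ) 0) t) :
    HasDerivAt (fun τ => max (u τ) 0) (if 0 ≤ u t then u' else 0) t := by
  rcases lt_trichotomy (u t) 0 with h | h | h
  · rw [if_neg (not_le.2 h)]
    refine (hasDerivAt_const t (0 : ℝ)).congr_of_eventuallyEq ?_
    filter_upwards [hu.continuousAt.eventually_lt_const h] with τ hτ using max_eq_right hτ.le
  · rw [if_pos h.ge]
    have h1 : deriv (fun τ => max (u τ) 0) t = 0 := by
      refine IsLocalMin.deriv_eq_zero (Filter.Eventually.of_forall fun τ => ?_)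
      simp [h]
    have h2 : deriv (fun τ => max (u τ) 0) t - u' = 0 := by
      rw [← (hd.hasDerivAt.sub hu).deriv]
      refine IsLocalMin.deriv_eq_zero (Filter.Eventually.of_forall fun τ => ?_)
      simp [h]
    have h3 : deriv (fun τ => max (u τ) 0) t = u' := by linarith
    exact h3 ▸ hd.hasDerivAt
  · rw [if_pos h.le]
    refine hu.congr_of_eventuallyEq ?_
    filter_upwards [hu.continuousAt.eventually_const_lt h] with τ hτ using max_eq_left hτ.le

/-- If the friction-corrected velocity `D' + c D` stays bounded by `M`, then so does `c D`. -/
lemma norm_le_of_norm_deriv_add_le {D V : ℝ → E} {c M T : ℝ} (hc : 0 < c) (hD0 : D 0 = 0)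
    (hD : ∀ t ∈ Set.Icc 0 T, HasDerivWithinAt D (V t) (Set.Icc 0 T) t)
    (hM : ∀ t ∈ Set.Icc 0 T, ‖V t + c • D t‖ ≤ M) {t : ℝ} (ht : t ∈ Set.Icc 0 T) :
    ‖D t‖ ≤ M / c := by
  have hexp : ∀ t, HasDerivAt (fun t => Real.exp (c * t)) (Real.exp (c * t) * c) t := fun t => by
    simpa using ((hasDerivAt_id t).const_mul c).exp
  have hM0 : 0 ≤ M := (norm_nonneg _).trans (hM t ht)
  have key := image_norm_le_of_norm_deriv_right_le_deriv_boundary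
    (f := fun t => Real.exp (c * t) • D t) (f' := fun t => Real.exp (c * t) • (V t + c • D t))
    (a := 0) (b := T)
    (B := fun t => M / c * Real.exp (c * t)) (B' := fun t => M / c * (Real.exp (c * t) * c))
    (fun t ht => ((hexp t).continuousAt.continuousWithinAt).smul (hD t ht).continuousWithinAt)
    (fun t ht => by
      have h1 := (hexp t).hasDerivWithinAt.fun_smul ((hD t ⟨ht.1, ht.2.le⟩).mono_of_mem_nhdsWithin
        (s := Set.Ici t) (Icc_mem_nhdsGE_of_mem ht))
      convert h1 using 1
      rw [smul_add, smul_smul])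
    (by simp only [hD0, smul_zero, norm_zero]; positivity)
    (fun t => (hexp t).const_mul _)
    (fun t ht => by
      rw [norm_smul, Real.norm_of_nonneg (Real.exp_pos _).le]
      have := mul_le_mul_of_nonneg_left (hM t ⟨ht.1, ht.2.le⟩) (Real.exp_pos (c * t)).le
      refine this.trans_eq ?_
      field_simp) ht
  simp only [norm_smul, Real.norm_of_nonneg (Real.exp_pos _).le] at key
  have hpos := Real.exp_pos (c * t)
  rw [mul_comm (M / c)] at key
  exact le_of_mul_le_mul_left key hpos

lemma integral_exp_neg_le {k : ℝ} (hk : 0 < k) (t : ℝ) :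
    ∫ τ in (0 : ℝ)..t, Real.exp (-(k * τ)) ≤ 1 / k := by
  have h : ∀ τ ∈ Set.uIcc 0 t,
      HasDerivAt (fun τ => -(1 / k) * Real.exp (-(k * τ))) (Real.exp (-(k * τ))) τ := fun τ _ => by
    have h1 : HasDerivAt (fun τ => -(k * τ)) (-k) τ := by
      simpa using ((hasDerivAt_id τ).const_mul k).fun_neg
    exact (h1.exp.const_mul (-(1 / k))).congr_deriv (by field_simp)
  rw [intervalIntegral.integral_eq_sub_of_hasDerivAt h
    ((by fun_prop : Continuous fun τ => Real.exp (-(k * τ))).intervalIntegrable _ _)]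
  have : 0 < 1 / k * Real.exp (-(k * t)) := by positivity
  simp only [mul_zero, neg_zero, Real.exp_zero]
  linarith

end AbsolutelyContinuous

/-! ### Regularity of the dynamics -/

section Dynamics

variable {n d m : ℕ}

/-- Hidden-layer weights with the Euclidean (Frobenius) norm. -/
abbrev State (m d : ℕ) : Type := PiLp 2 (fun _ : Fin m => Vec d)

/-- A shortcut for a search that is expensive in the nested `PiLp` spaces. -/
instance : ContinuousSMul ℝ (State m d) := IsBoundedSMul.continuousSMul

/-- Jacobian of the outputs `(f_i)_i` with respect to the weights, `v ↦ (∑_r ⟪∂f_i/∂w_r, v_r⟫)_i`. -/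
noncomputable def jac (x : Fin n → Vec d) (a : Fin m → ℝ) (w : Weights m d) :
    State m d →ₗ[ℝ] EuclideanSpace ℝ (Fin n) where
  toFun v := WithLp.toLp 2 fun i => ∑ r, inner ℝ (outGrad x a w i r) (v r)
  map_add' u v := by
    ext i; simp [inner_add_right, Finset.sum_add_distrib]
  map_smul' c v := by
    ext i; simp [inner_smul_right, Finset.mul_sum]

/-- Transpose of `jac`, `u ↦ (∑_i u_i ∂f_i/∂w_r)_r`. -/
noncomputable def jacT (x : Fin n → Vec d) (a : Fin m → ℝ) (w : Weights m d) :
    EuclideanSpace ℝ (Fin n) →ₗ[ℝ] State m d where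
  toFun u := WithLp.toLp 2 fun r => ∑ i, u i • outGrad x a w i r
  map_add' u v := by
    ext1 r; simp [add_smul, Finset.sum_add_distrib]
  map_smul' c v := by
    ext1 r; simp [mul_smul, Finset.smul_sum]

@[simp] lemma jac_apply (x : Fin n → Vec d) (a : Fin m → ℝ) (w : Weights m d) (v : State m d)
    (i : Fin n) : jac x a w v i = ∑ r, inner ℝ (outGrad x a w i r) (v r) := rfl

@[simp] lemma jacT_apply (x : Fin n → Vec d) (a : Fin m → ℝ) (w : Weights m d)
    (u : EuclideanSpace ℝ (Fin n)) (r : Fin m) :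
    jacT x a w u r = ∑ i, u i • outGrad x a w i r := rfl

lemma inner_jacT (x : Fin n → Vec d) (a : Fin m → ℝ) (w : Weights m d)
    (u : EuclideanSpace ℝ (Fin n)) (v : State m d) :
    inner ℝ (jacT x a w u) v = inner ℝ u (jac x a w v) := by
  simp only [PiLp.inner_apply, jacT_apply, jac_apply, sum_inner, inner_smul_left, conj_trivial]
  rw [Finset.sum_comm]
  refine Finset.sum_congr rfl fun i _ => ?_
  rw [← Finset.mul_sum]
  simp [mul_comm]

/-- The acceleration prescribed by the ODE. -/
noncomputable def accel (x : Fin n → Vec d) (y : Fin n → ℝ) (a : Fin m → ℝ)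
    (K : Weights m d → Weights m d → Weights m d) (s : ℝ) (w v : Weights m d) (r : Fin m) : Vec d :=
  -(√(2 * lam0 x) • v r + √s • K w v r + (1 + √(lam0 x * s / 2)) • lossGrad x y a w r)

variable {x : Fin n → Vec d} {y : Fin n → ℝ} {a : Fin m → ℝ}
  {K : Weights m d → Weights m d → Weights m d} {s T : ℝ} {W V : ℝ → Weights m d}

namespace IsNAGSolution

lemma restrict (h : IsNAGSolution x y a K s T W V) {t : ℝ} (ht : t ≤ T) :
    IsNAGSolution x y a K s t W V where
  hasDeriv τ hτ r := (h.hasDeriv τ ⟨hτ.1, hτ.2.trans ht⟩ r).mono (Set.Icc_subset_Icc_right ht)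
  init_velocity := h.init_velocity
  integrable τ hτ := h.integrable τ ⟨hτ.1, hτ.2.trans ht⟩
  velocity τ hτ := h.velocity τ ⟨hτ.1, hτ.2.trans ht⟩

lemma intervalIntegrable_accel (h : IsNAGSolution x y a K s T W V) (hT : 0 ≤ T) (r : Fin m) :
    IntervalIntegrable (fun τ => accel x y a K s (W τ) (V τ) r) volume 0 T :=
  h.integrable T ⟨hT, le_rfl⟩ r

lemma velocity_eq (h : IsNAGSolution x y a K s T W V) (r : Fin m) {t : ℝ}
    (ht : t ∈ Set.Icc 0 T) :
    V t r = V 0 r + ∫ τ in (0 : ℝ)..t, accel x y a K s (W τ) (V τ) r :=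
  h.velocity t ht r

lemma continuousOn_velocity (h : IsNAGSolution x y a K s T W V) (hT : 0 ≤ T) (r : Fin m) :
    ContinuousOn (fun t => V t r) (Set.Icc 0 T) := by
  have h1 := intervalIntegral.continuousOn_primitive_interval' (h.intervalIntegrable_accel hT r)
    (Set.left_mem_uIcc)
  rw [Set.uIcc_of_le hT] at h1
  exact (continuousOn_const.add h1).congr fun t ht => h.velocity_eq r ht

lemma hasDerivAt_weight (h : IsNAGSolution x y a K s T W V) (r : Fin m) {t : ℝ}
    (ht : t ∈ Set.Ioo 0 T) : HasDerivAt (fun τ => W τ r) (V t r) t :=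
  (h.hasDeriv t (Set.Ioo_subset_Icc_self ht) r).hasDerivAt (Icc_mem_nhds ht.1 ht.2)

lemma intervalIntegrable_velocity (h : IsNAGSolution x y a K s T W V) (hT : 0 ≤ T) (r : Fin m) :
    IntervalIntegrable (fun τ => V τ r) volume 0 T :=
  ContinuousOn.intervalIntegrable (by simpa [Set.uIcc_of_le hT] using h.continuousOn_velocity hT r)

lemma weight_eq (h : IsNAGSolution x y a K s T W V) (r : Fin m) {t : ℝ}
    (ht : t ∈ Set.Icc 0 T) : W t r = W 0 r + ∫ τ in (0 : ℝ)..t, V τ r := by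
  have ht' := h.restrict ht.2
  rw [intervalIntegral.integral_eq_sub_of_hasDerivAt_of_le ht.1
    (fun τ hτ => (ht'.hasDeriv τ hτ r).continuousWithinAt)
    (fun τ hτ => ht'.hasDerivAt_weight r hτ) (ht'.intervalIntegrable_velocity ht.1 r)]
  abel

lemma ac_velocity (h : IsNAGSolution x y a K s T W V) (hT : 0 ≤ T) (r : Fin m) (e : Vec d) :
    AbsolutelyContinuousOnInterval (fun t => inner ℝ e (V t r)) 0 T :=
  absolutelyContinuousOnInterval_congr
    (absolutelyContinuousOnInterval_integral (h.intervalIntegrable_accel hT r) (V 0 r) e)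
    fun t ht => by
      rw [Set.uIcc_of_le hT] at ht
      simp only [← h.velocity_eq r ht]

lemma ac_weight (h : IsNAGSolution x y a K s T W V) (hT : 0 ≤ T) (r : Fin m) (e : Vec d) :
    AbsolutelyContinuousOnInterval (fun t => inner ℝ e (W t r)) 0 T :=
  absolutelyContinuousOnInterval_congr
    (absolutelyContinuousOnInterval_integral (h.intervalIntegrable_velocity hT r) (W 0 r) e)
    fun t ht => by
      rw [Set.uIcc_of_le hT] at ht
      simp only [← h.weight_eq r ht]

lemma ac_relu (h : IsNAGSolution x y a K s T W V) (hT : 0 ≤ T) (r : Fin m) (i : Fin n) :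
    AbsolutelyContinuousOnInterval (fun t => max (inner ℝ (W t r) (x i) : ℝ) 0) 0 T := by
  have := absolutelyContinuousOnInterval_comp_lipschitz (h.ac_weight hT r (x i))
    (LipschitzWith.id.max_const 0)
  simpa only [real_inner_comm, id] using this

lemma ac_residual (h : IsNAGSolution x y a K s T W V) (hT : 0 ≤ T) (i : Fin n) :
    AbsolutelyContinuousOnInterval (fun t => residual x y a (W t) i) 0 T :=
  ((absolutelyContinuousOnInterval_sum Finset.univ fun r _ =>
    (h.ac_relu hT r i).const_mul (a r)).const_mul (1 / √(m : ℝ))).fun_sub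
      (absolutelyContinuousOnInterval_const (y i))

lemma ae_hasDerivAt_velocity (h : IsNAGSolution x y a K s T W V) (hT : 0 ≤ T) :
    ∀ᵐ t, t ∈ Set.Ioo 0 T → ∀ r,
      HasDerivAt (fun τ => V τ r) (accel x y a K s (W t) (V t) r) t := by
  have h1 := ae_all_iff.2 fun r => (h.intervalIntegrable_accel hT r).ae_hasDerivAt_integral
  filter_upwards [h1] with t ht htT r
  have h2 := ht r (by rw [Set.uIcc_of_le hT]; exact Set.Ioo_subset_Icc_self htT) 0
    Set.left_mem_uIcc
  refine (h2.const_add (V 0 r)).congr_of_eventuallyEq ?_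
  filter_upwards [Icc_mem_nhds htT.1 htT.2] with τ hτ using h.velocity_eq r hτ

/-- Almost everywhere in time the outputs have the derivative given by the formal Jacobian. -/
lemma ae_hasDerivAt_residual (h : IsNAGSolution x y a K s T W V) (hT : 0 ≤ T) :
    ∀ᵐ t, t ∈ Set.Ioo 0 T → ∀ i, HasDerivAt (fun τ => residual x y a (W τ) i)
      (jac x a (W t) (WithLp.toLp 2 (V t)) i) t := by
  have h1 := ae_all_iff.2 fun r => ae_all_iff.2 fun i => (h.ac_relu hT r i).ae_differentiableAt
  filter_upwards [h1] with t ht htT i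
  have h2 : ∀ r, HasDerivAt (fun τ => max (inner ℝ (W τ r) (x i) : ℝ) 0)
      (if 0 ≤ inner ℝ (W t r) (x i) then inner ℝ (V t r) (x i) else 0) t := fun r => by
    refine hasDerivAt_max_zero ?_
      (ht r i (by rw [Set.uIcc_of_le hT]; exact Set.Ioo_subset_Icc_self htT))
    simpa using (h.hasDerivAt_weight r htT).inner ℝ (hasDerivAt_const t (x i))
  have h3 := ((HasDerivAt.fun_sum fun r (_ : r ∈ Finset.univ) =>
    (h2 r).const_mul (a r)).const_mul (1 / √(m : ℝ))).sub_const (y i)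
  refine h3.congr_deriv ?_
  rw [jac_apply, Finset.mul_sum]
  refine Finset.sum_congr rfl fun r _ => ?_
  unfold outGrad
  split_ifs
  · rw [inner_smul_left, real_inner_comm (V t r)]
    simp only [conj_trivial]
    ring
  · simp

end IsNAGSolution

/-- If the energy satisfies a pointwise differential inequality along the formal derivatives, it
decays exponentially along the solution. -/
lemma IsNAGSolution.energy_le (h : IsNAGSolution x y a K s T W V) (hT : 0 ≤ T)
    (A : State m d →ₗ[ℝ] EuclideanSpace ℝ (Fin n)) (γ b c : ℝ)
    (hder : ∀ t ∈ Set.Icc 0 T, ∀ v v' : State m d, ∀ z : EuclideanSpace ℝ (Fin n),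
      v = WithLp.toLp 2 (V t) → v' = WithLp.toLp 2 (accel x y a K s (W t) (V t)) →
      z = WithLp.toLp 2 (residual x y a (W t)) →
      inner ℝ v v' + b * inner ℝ z (jac x a (W t) v)
        + γ * (inner ℝ (A v') z + inner ℝ (A v) (jac x a (W t) v)) ≤ -c * energy A γ b v z) :
    energy A γ b (WithLp.toLp 2 (V T)) (WithLp.toLp 2 (residual x y a (W T))) ≤
      energy A γ b (WithLp.toLp 2 (V 0)) (WithLp.toLp 2 (residual x y a (W 0)))
        * Real.exp (-(c * T)) := by
  have hv : ∀ e : State m d, AbsolutelyContinuousOnInterval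
      (fun t => inner ℝ e (WithLp.toLp 2 (V t) : State m d)) 0 T := fun e => by
    simp only [PiLp.inner_apply]
    exact absolutelyContinuousOnInterval_sum Finset.univ fun r _ => h.ac_velocity hT r (e r)
  have hz : ∀ e : EuclideanSpace ℝ (Fin n), AbsolutelyContinuousOnInterval
      (fun t => inner ℝ e (WithLp.toLp 2 (residual x y a (W t)) : EuclideanSpace ℝ (Fin n)))
      0 T := fun e => by
    simp only [PiLp.inner_apply]
    refine absolutelyContinuousOnInterval_sum Finset.univ fun i _ => ?_
    simpa [mul_comm] using (h.ac_residual hT i).const_mul (e i)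
  refine le_mul_exp_of_ae_deriv_le (f := fun t => energy A γ b (WithLp.toLp 2 (V t))
    (WithLp.toLp 2 (residual x y a (W t)))) hT ?_ ?_
  · exact absolutelyContinuousOnInterval_energy A γ b hv hz
  · filter_upwards [h.ae_hasDerivAt_velocity hT, h.ae_hasDerivAt_residual hT] with t h1 h2 ht
    have hv' : HasDerivAt (fun τ => (WithLp.toLp 2 (V τ) : State m d))
        (WithLp.toLp 2 (accel x y a K s (W t) (V t))) t :=
      (PiLp.continuousLinearEquiv 2 ℝ (fun _ : Fin m => Vec d)).symm.hasFDerivAt.comp_hasDerivAt t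
        (hasDerivAt_pi.2 (h1 ht))
    have hz' : HasDerivAt
        (fun τ => (WithLp.toLp 2 (residual x y a (W τ)) : EuclideanSpace ℝ (Fin n)))
        (jac x a (W t) (WithLp.toLp 2 (V t))) t :=
      (PiLp.continuousLinearEquiv 2 ℝ (fun _ : Fin n => ℝ)).symm.hasFDerivAt.comp_hasDerivAt t
        (hasDerivAt_pi.2 (h2 ht))
    exact ⟨_, hasDerivAt_energy A γ b hv' hz',
      hder t (Set.Ioo_subset_Icc_self ht) _ _ _ rfl rfl rfl⟩

end Dynamics

/-! ### Perturbation of the Jacobian near the initialization -/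

section Transpose

variable {F X : Type*} [NormedAddCommGroup F] [InnerProductSpace ℝ F]
  [NormedAddCommGroup X] [InnerProductSpace ℝ X]

/-- An operator and its transpose have the same norm bounds. -/
lemma norm_sq_le_of_transpose {D : F → X} {Dt : X → F} {c : ℝ}
    (hadj : ∀ u v, inner ℝ (Dt u) v = inner ℝ u (D v)) (hc : 0 ≤ c)
    (hD : ∀ v, ‖D v‖ ^ 2 ≤ c * ‖v‖ ^ 2) (u : X) : ‖Dt u‖ ^ 2 ≤ c * ‖u‖ ^ 2 := by
  have h1 : ‖Dt u‖ ^ 2 ≤ ‖u‖ * ‖D (Dt u)‖ := by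
    rw [← real_inner_self_eq_norm_sq, hadj]
    exact real_inner_le_norm _ _
  have h2 : (‖Dt u‖ ^ 2) ^ 2 ≤ (c * ‖u‖ ^ 2) * ‖Dt u‖ ^ 2 :=
    calc (‖Dt u‖ ^ 2) ^ 2 ≤ (‖u‖ * ‖D (Dt u)‖) ^ 2 := by gcongr
      _ = ‖u‖ ^ 2 * ‖D (Dt u)‖ ^ 2 := by ring
      _ ≤ ‖u‖ ^ 2 * (c * ‖Dt u‖ ^ 2) := by gcongr; exact hD _
      _ = _ := by ring
  rcases (sq_nonneg ‖Dt u‖).eq_or_lt with h | h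
  · rw [← h]; positivity
  · exact le_of_mul_le_mul_right (by linarith [h2, sq (‖Dt u‖ ^ 2)]) h

end Transpose

section Perturbation

variable {n d m : ℕ}

/-- Indicator that neuron `r` is within distance `R` of the activation boundary of `x_i`. -/
noncomputable def nearInd (x : Fin n → Vec d) (R : ℝ) (w : Weights m d) (i : Fin n) (r : Fin m) :
    ℝ :=
  if |(inner ℝ (w r) (x i) : ℝ)| ≤ R then 1 else 0

/-- Number of pairs (neuron, sample) within distance `R` of the activation boundary, divided by
the number `m` of neurons. -/
noncomputable def nearFrac (x : Fin n → Vec d) (R : ℝ) (w : Weights m d) : ℝ :=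
  ∑ i, ∑ r, nearInd x R w i r / m

variable {x : Fin n → Vec d} {y : Fin n → ℝ} {a : Fin m → ℝ} {w w₀ : Weights m d} {R : ℝ}

lemma nearInd_nonneg (i : Fin n) (r : Fin m) : 0 ≤ nearInd x R w i r := by
  unfold nearInd; split_ifs <;> norm_num

lemma nearFrac_nonneg : 0 ≤ nearFrac x R w :=
  Finset.sum_nonneg fun i _ => Finset.sum_nonneg fun r _ =>
    div_nonneg (nearInd_nonneg i r) (Nat.cast_nonneg m)

lemma norm_outGrad_le (hx : ∀ i, ‖x i‖ = 1) (ha : ∀ r, |a r| = 1) (i : Fin n) (r : Fin m) :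
    ‖outGrad x a w i r‖ ≤ 1 / √(m : ℝ) := by
  unfold outGrad
  split_ifs
  · rw [norm_smul, hx, mul_one, Real.norm_eq_abs, abs_div, ha, abs_of_nonneg (Real.sqrt_nonneg _)]
  · simp

/-- A neuron that moved by at most `R` changed its activation on `x_i` only if it started within
distance `R` of the activation boundary. -/
lemma norm_outGrad_sub_le (hx : ∀ i, ‖x i‖ = 1) (ha : ∀ r, |a r| = 1)
    (hw : ∀ r, ‖w r - w₀ r‖ ≤ R) (i : Fin n) (r : Fin m) :
    ‖outGrad x a w i r - outGrad x a w₀ i r‖ ≤ nearInd x R w₀ i r * (1 / √(m : ℝ)) := by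
  have hdiff : |(inner ℝ (w r) (x i) : ℝ) - inner ℝ (w₀ r) (x i)| ≤ R := by
    rw [← inner_sub_left]
    refine (abs_real_inner_le_norm _ _).trans ?_
    rw [hx, mul_one]; exact hw r
  have hd := abs_le.1 hdiff
  unfold outGrad nearInd
  split_ifs with h1 h2 h3 h3 h2 h3 h3
  · simp
  · simp
  · simp [norm_smul, hx, ha, abs_of_nonneg (Real.sqrt_nonneg _)]
  · exact absurd (abs_le.2 ⟨by linarith, by linarith⟩) h3
  · simp [norm_smul, hx, ha, abs_of_nonneg (Real.sqrt_nonneg _)]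
  · exact absurd (abs_le.2 ⟨by linarith, by linarith⟩) h3
  · simp
  · simp

lemma inv_sqrt_mul_inv_sqrt : 1 / √(m : ℝ) * (1 / √(m : ℝ)) = 1 / m := by
  rw [div_mul_div_comm, one_mul, Real.mul_self_sqrt (Nat.cast_nonneg m)]

lemma norm_sq_jac_sub_le (hx : ∀ i, ‖x i‖ = 1) (ha : ∀ r, |a r| = 1)
    (hw : ∀ r, ‖w r - w₀ r‖ ≤ R) (v : State m d) :
    ‖jac x a w v - jac x a w₀ v‖ ^ 2 ≤ nearFrac x R w₀ * ‖v‖ ^ 2 := by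
  rw [EuclideanSpace.norm_sq_eq, nearFrac, Finset.sum_mul]
  refine Finset.sum_le_sum fun i _ => ?_
  have h1 : (jac x a w v - jac x a w₀ v) i =
      ∑ r, inner ℝ (outGrad x a w i r - outGrad x a w₀ i r) (v r) := by
    simp [inner_sub_left, Finset.sum_sub_distrib]
  have h2 : |∑ r, (inner ℝ (outGrad x a w i r - outGrad x a w₀ i r) (v r) : ℝ)| ≤
      ∑ r, (nearInd x R w₀ i r * (1 / √(m : ℝ))) * ‖v r‖ :=
    (Finset.abs_sum_le_sum_abs _ _).trans (Finset.sum_le_sum fun r _ =>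
      (abs_real_inner_le_norm _ _).trans (mul_le_mul_of_nonneg_right
        (norm_outGrad_sub_le hx ha hw i r) (norm_nonneg _)))
  rw [h1, Real.norm_eq_abs]
  refine (pow_le_pow_left₀ (abs_nonneg _) h2 2).trans
    ((Finset.sum_mul_sq_le_sq_mul_sq _ _ _).trans ?_)
  rw [PiLp.norm_sq_eq_of_L2]
  refine mul_le_mul_of_nonneg_right (Finset.sum_le_sum fun r _ => ?_)
    (Finset.sum_nonneg fun r _ => sq_nonneg _)
  rw [mul_pow, sq (1 / √(m : ℝ)), inv_sqrt_mul_inv_sqrt]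
  unfold nearInd
  split_ifs <;> simp

lemma abs_le_norm (u : EuclideanSpace ℝ (Fin n)) (i : Fin n) : |u i| ≤ ‖u‖ := by
  simpa using PiLp.norm_apply_le u i

/-- The change of the Jacobian is small relative to the initial Gram matrix, and not only relative
to the initial Jacobian: every entry of `J₀ (J - J₀)ᵀ` is controlled by the near-boundary count,
not by its square root. -/
lemma norm_jac_jacT_sub_le (hx : ∀ i, ‖x i‖ = 1) (ha : ∀ r, |a r| = 1)
    (hw : ∀ r, ‖w r - w₀ r‖ ≤ R) (u : EuclideanSpace ℝ (Fin n)) :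
    ‖jac x a w₀ (jacT x a w u - jacT x a w₀ u)‖ ≤ n * nearFrac x R w₀ * ‖u‖ := by
  have h1 : ∀ j, |jac x a w₀ (jacT x a w u - jacT x a w₀ u) j| ≤ nearFrac x R w₀ * ‖u‖ := by
    intro j
    have h2 : jac x a w₀ (jacT x a w u - jacT x a w₀ u) j = ∑ i, ∑ r,
        u i * inner ℝ (outGrad x a w₀ j r) (outGrad x a w i r - outGrad x a w₀ i r) := by
      rw [Finset.sum_comm]
      simp only [jac_apply, PiLp.sub_apply, jacT_apply, ← Finset.sum_sub_distrib, ← smul_sub,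
        inner_sum, inner_smul_right]
    rw [h2, nearFrac, Finset.sum_mul]
    refine (Finset.abs_sum_le_sum_abs _ _).trans (Finset.sum_le_sum fun i _ => ?_)
    rw [Finset.sum_mul]
    refine (Finset.abs_sum_le_sum_abs _ _).trans (Finset.sum_le_sum fun r _ => ?_)
    rw [abs_mul]
    calc _ ≤ ‖u‖ * (1 / √(m : ℝ) * (nearInd x R w₀ i r * (1 / √(m : ℝ)))) := by
          refine mul_le_mul (abs_le_norm u i) ((abs_real_inner_le_norm _ _).trans ?_)
            (abs_nonneg _) (norm_nonneg _)
          exact mul_le_mul (norm_outGrad_le hx ha j r) (norm_outGrad_sub_le hx ha hw i r)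
            (norm_nonneg _) (by positivity)
      _ = ‖u‖ * (nearInd x R w₀ i r * (1 / √(m : ℝ) * (1 / √(m : ℝ)))) := by ring
      _ = _ := by rw [inv_sqrt_mul_inv_sqrt]; ring
  have h0 : 0 ≤ nearFrac x R w₀ * ‖u‖ := mul_nonneg nearFrac_nonneg (norm_nonneg _)
  refine le_of_sq_le_sq ?_ (by rw [mul_assoc]; positivity)
  rw [EuclideanSpace.norm_sq_eq]
  calc _ ≤ ∑ _j : Fin n, (nearFrac x R w₀ * ‖u‖) ^ 2 := Finset.sum_le_sum fun j _ => by
        rw [Real.norm_eq_abs]; exact pow_le_pow_left₀ (abs_nonneg _) (h1 j) 2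
    _ = n * (nearFrac x R w₀ * ‖u‖) ^ 2 := by simp
    _ ≤ (n : ℝ) ^ 2 * (nearFrac x R w₀ * ‖u‖) ^ 2 := by
        gcongr
        exact_mod_cast Nat.le_self_pow two_ne_zero n
    _ = _ := by ring

lemma norm_jacT_apply_le (hx : ∀ i, ‖x i‖ = 1) (ha : ∀ r, |a r| = 1)
    (u : EuclideanSpace ℝ (Fin n)) (r : Fin m) :
    ‖jacT x a w u r‖ ≤ √((n : ℝ) / m) * ‖u‖ := by
  rw [jacT_apply]
  have h1 : ∑ i, |u i| ≤ √(n : ℝ) * ‖u‖ := by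
    refine le_of_sq_le_sq ?_ (by positivity)
    rw [mul_pow, Real.sq_sqrt (Nat.cast_nonneg n), EuclideanSpace.norm_sq_eq]
    simpa using sq_sum_le_card_mul_sum_sq (s := (Finset.univ : Finset (Fin n))) (f := fun i => |u i|)
  calc _ ≤ ∑ i, |u i| * (1 / √(m : ℝ)) := (norm_sum_le _ _).trans (Finset.sum_le_sum fun i _ => by
        rw [norm_smul, Real.norm_eq_abs]
        exact mul_le_mul_of_nonneg_left (norm_outGrad_le hx ha i r) (abs_nonneg _))
    _ = (∑ i, |u i|) * (1 / √(m : ℝ)) := by rw [Finset.sum_mul]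
    _ ≤ √(n : ℝ) * ‖u‖ * (1 / √(m : ℝ)) := by gcongr
    _ = _ := by rw [Real.sqrt_div (Nat.cast_nonneg n)]; ring

lemma norm_hessBlock_le (hx : ∀ i, ‖x i‖ = 1) (ha : ∀ r, |a r| = 1) (v : Weights m d) (r : Fin m) :
    ‖hessBlock x a w v r‖ ≤ (n : ℝ) / m * ‖v r‖ := by
  unfold hessBlock
  calc _ ≤ ∑ _i : Fin n, (1 / √(m : ℝ) * ‖v r‖) * (1 / √(m : ℝ)) :=
        (norm_sum_le _ _).trans (Finset.sum_le_sum fun i _ => by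
          rw [norm_smul, Real.norm_eq_abs]
          refine mul_le_mul ((abs_real_inner_le_norm _ _).trans ?_) (norm_outGrad_le hx ha i r)
            (norm_nonneg _) (by positivity)
          exact mul_le_mul_of_nonneg_right (norm_outGrad_le hx ha i r) (norm_nonneg _))
    _ = n * (1 / √(m : ℝ) * (1 / √(m : ℝ))) * ‖v r‖ := by simp; ring
    _ = _ := by rw [inv_sqrt_mul_inv_sqrt]; ring

lemma norm_sq_jacT (u : EuclideanSpace ℝ (Fin n)) :
    ‖jacT x a w u‖ ^ 2 = ∑ i, ∑ j, u i * gram x a w i j * u j := by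
  rw [PiLp.norm_sq_eq_of_L2]
  simp_rw [← real_inner_self_eq_norm_sq, jacT_apply, sum_inner, inner_sum, inner_smul_left,
    inner_smul_right, conj_trivial, gram, Matrix.of_apply, Finset.mul_sum, Finset.sum_mul]
  rw [Finset.sum_comm]
  refine Finset.sum_congr rfl fun i _ => ?_
  rw [Finset.sum_comm]
  exact Finset.sum_congr rfl fun j _ => Finset.sum_congr rfl fun r _ => by ring

lemma pseudoLoss_eq : pseudoLoss x y a w =
    1 / 2 * ‖jacT x a w (WithLp.toLp 2 (residual x y a w))‖ ^ 2 := by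
  rw [norm_sq_jacT]; rfl

lemma loss_eq : loss x y a w =
    1 / 2 * ‖(WithLp.toLp 2 (residual x y a w) : EuclideanSpace ℝ (Fin n))‖ ^ 2 := by
  rw [EuclideanSpace.norm_sq_eq]; simp [loss]

/-- A quadratic form is bounded by the Frobenius norm of its matrix. -/
lemma abs_quadForm_le {M : Matrix (Fin n) (Fin n) ℝ} {c : ℝ} (hc : 0 ≤ c)
    (hM : ∑ i, ∑ j, M i j ^ 2 ≤ c ^ 2) (u : EuclideanSpace ℝ (Fin n)) :
    |∑ i, ∑ j, u i * M i j * u j| ≤ c * ‖u‖ ^ 2 := by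
  refine abs_le_of_sq_le_sq ?_ (by positivity)
  have h1 : ∑ i, ∑ j, u i * M i j * u j =
      ∑ p : Fin n × Fin n, M p.1 p.2 * (u p.1 * u p.2) := by
    rw [Fintype.sum_prod_type]
    exact Finset.sum_congr rfl fun i _ => Finset.sum_congr rfl fun j _ => by ring
  have h2 : ∑ p : Fin n × Fin n, (u p.1 * u p.2) ^ 2 = (‖u‖ ^ 2) ^ 2 := by
    rw [Fintype.sum_prod_type, EuclideanSpace.norm_sq_eq, sq (∑ i, ‖u i‖ ^ 2), Finset.sum_mul_sum]
    simp [mul_pow]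
  rw [h1, mul_pow]
  refine (Finset.sum_mul_sq_le_sq_mul_sq _ _ _).trans ?_
  rw [h2, Fintype.sum_prod_type]
  gcongr

lemma isHermitian_gramInf : (gramInf x).IsHermitian := by
  ext i j
  simp only [gramInf, Matrix.conjTranspose_apply, Matrix.of_apply, star_trivial]
  refine integral_congr_ae (Filter.Eventually.of_forall fun w => ?_)
  simp only [and_comm, real_inner_comm]

lemma quadForm_gramInf_bounds (u : EuclideanSpace ℝ (Fin n)) :
    lam0 x * ‖u‖ ^ 2 ≤ ∑ i, ∑ j, u i * gramInf x i j * u j ∧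
    ∑ i, ∑ j, u i * gramInf x i j * u j ≤ sSup (spectrum ℝ (gramInf x)) * ‖u‖ ^ 2 := by
  have hH := isHermitian_gramInf (x := x)
  have hfin : (spectrum ℝ (gramInf x)).Finite := Matrix.finite_real_spectrum
  have hmem : ∀ k, hH.eigenvalues k ∈ spectrum ℝ (gramInf x) := fun k => by
    rw [hH.spectrum_real_eq_range_eigenvalues]; exact ⟨k, rfl⟩
  have hq : ∑ i, ∑ j, u i * gramInf x i j * u j =
      ∑ k, hH.eigenvalues k * (inner ℝ (hH.eigenvectorBasis k) u) ^ 2 := by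
    have h1 : ∑ i, ∑ j, u i * gramInf x i j * u j =
        inner ℝ u (Matrix.toEuclideanLin (gramInf x) u) := by
      simp only [PiLp.inner_apply, Matrix.toLpLin_apply, Matrix.mulVec, dotProduct]
      refine Finset.sum_congr rfl fun i _ => ?_
      simp only [RCLike.inner_apply, conj_trivial, Finset.sum_mul]
      exact Finset.sum_congr rfl fun j _ => by ring
    rw [h1, ← hH.eigenvectorBasis.sum_inner_mul_inner]
    refine Finset.sum_congr rfl fun k _ => ?_
    have h2 : (inner ℝ (hH.eigenvectorBasis k) (Matrix.toEuclideanLin (gramInf x) u) : ℝ) =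
        hH.eigenvalues k * inner ℝ (hH.eigenvectorBasis k) u := by
      rw [← (Matrix.isSymmetric_toEuclideanLin_iff.2 hH) _ _]
      have h3 : Matrix.toEuclideanLin (gramInf x) (hH.eigenvectorBasis k) =
          hH.eigenvalues k • hH.eigenvectorBasis k := by
        ext i
        simpa [Matrix.toLpLin_apply] using congrFun (hH.mulVec_eigenvectorBasis k) i
      rw [h3, inner_smul_left]; simp
    rw [h2, real_inner_comm]
    ring
  have hn : ‖u‖ ^ 2 = ∑ k, (inner ℝ (hH.eigenvectorBasis k) u : ℝ) ^ 2 := by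
    rw [← hH.eigenvectorBasis.sum_sq_norm_inner_right u]
    simp
  rw [hq, hn, Finset.mul_sum, Finset.mul_sum]
  exact ⟨Finset.sum_le_sum fun k _ => mul_le_mul_of_nonneg_right
      (csInf_le hfin.bddBelow (hmem k)) (sq_nonneg _),
    Finset.sum_le_sum fun k _ => mul_le_mul_of_nonneg_right
      (le_csSup hfin.bddAbove (hmem k)) (sq_nonneg _)⟩

end Perturbation

/-! ### Convergence from a good initialization -/

section Convergence

variable {n d m : ℕ}

/-- The deterministic conditions on the initialization `(w, a)` under which the dynamics converge.
`R` bounds the distance any neuron will travel. -/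
structure GoodInit (x : Fin n → Vec d) (y : Fin n → ℝ) (R : ℝ) (a : Fin m → ℝ)
    (w : Weights m d) : Prop where
  sign : ∀ r, |a r| = 1
  gram_close : ∑ i, ∑ j, (gram x a w i j - gramInf x i j) ^ 2 ≤ (lam0 x / 10) ^ 2
  near_le : n * nearFrac x R w ≤ lam0 x / 500
  travel_lt : 27 * √((n : ℝ) / m) *
    ‖(WithLp.toLp 2 (residual x y a w) : EuclideanSpace ℝ (Fin n))‖ / lam0 x < R
  width : (n : ℝ) / m ≤ lam0 x / 40

variable {x : Fin n → Vec d} {y : Fin n → ℝ} {a : Fin m → ℝ} {w w₀ : Weights m d} {R : ℝ}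

namespace GoodInit

lemma radius_pos (h : GoodInit x y R a w₀) (hl : 0 < lam0 x) : 0 < R :=
  lt_of_le_of_lt (by positivity) h.travel_lt

lemma nearFrac_le (h : GoodInit x y R a w₀) (hn : 0 < n) : nearFrac x R w₀ ≤ lam0 x / 500 := by
  refine le_trans ?_ h.near_le
  have : (1 : ℝ) ≤ n := by exact_mod_cast hn
  nlinarith [nearFrac_nonneg (x := x) (R := R) (w := w₀)]

lemma norm_sq_jacT_bounds (h : GoodInit x y R a w₀) (hl : 0 < lam0 x)
    (u : EuclideanSpace ℝ (Fin n)) :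
    9 / 10 * lam0 x * ‖u‖ ^ 2 ≤ ‖jacT x a w₀ u‖ ^ 2 ∧
    ‖jacT x a w₀ u‖ ^ 2 ≤ (sSup (spectrum ℝ (gramInf x)) + lam0 x / 10) * ‖u‖ ^ 2 := by
  have h1 := abs_le.1 (abs_quadForm_le (M := gram x a w₀ - gramInf x) (c := lam0 x / 10)
    (by positivity) (by simpa using h.gram_close) u)
  have h2 : ∑ i, ∑ j, u i * (gram x a w₀ - gramInf x) i j * u j =
      ‖jacT x a w₀ u‖ ^ 2 - ∑ i, ∑ j, u i * gramInf x i j * u j := by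
    rw [norm_sq_jacT]
    simp [mul_sub, sub_mul, Finset.sum_sub_distrib]
  rw [h2] at h1
  have h3 := quadForm_gramInf_bounds (x := x) u
  constructor <;> linarith [h1.1, h1.2, h3.1, h3.2]

/-- The transposed pseudo-inverse `A` of the initial Jacobian is an approximate transposed
pseudo-inverse of the Jacobian at all weights within distance `R`. -/
lemma exists_pseudoInverse (h : GoodInit x y R a w₀) (hn : 0 < n) (hx : ∀ i, ‖x i‖ = 1)
    (hl : 0 < lam0 x) :
    ∃ A : State m d →ₗ[ℝ] EuclideanSpace ℝ (Fin n),
      (∀ v, √(lam0 x / 2) * ‖A v‖ ≤ 3 / 4 * ‖v‖) ∧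
      ∀ w : Weights m d, (∀ r, ‖w r - w₀ r‖ ≤ R) →
        (∀ v, inner ℝ (A v) (jac x a w v) ≤ 21 / 20 * ‖v‖ ^ 2) ∧
        (∀ u, ‖A (jacT x a w u) - u‖ ≤ 1 / 20 * ‖u‖) := by
  obtain ⟨N, hN1, hN2, hN3, hN4⟩ := exists_gram_inverse (jac x a w₀) (jacT x a w₀)
    (inner_jacT x a w₀) (μ := 9 / 10 * lam0 x) (by positivity) fun u => (h.norm_sq_jacT_bounds hl u).1
  refine ⟨N ∘ₗ jac x a w₀, fun v => ?_, fun w hw => ⟨fun v => ?_, fun u => ?_⟩⟩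
  · refine le_of_sq_le_sq ?_ (by positivity)
    have h1 := hN3 v
    rw [mul_pow, mul_pow, Real.sq_sqrt (by positivity)]
    simp only [LinearMap.comp_apply]
    nlinarith [sq_nonneg ‖v‖]
  · have h1 := norm_sq_jac_sub_le hx h.sign hw v
    have h2 := hN3 v
    have h3 : ‖N (jac x a w₀ v)‖ * ‖jac x a w v - jac x a w₀ v‖ ≤ 1 / 20 * ‖v‖ ^ 2 := by
      refine le_of_sq_le_sq ?_ (by positivity)
      have h4 : ‖jac x a w v - jac x a w₀ v‖ ^ 2 ≤ lam0 x / 500 * ‖v‖ ^ 2 :=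
        h1.trans (mul_le_mul_of_nonneg_right (h.nearFrac_le hn) (sq_nonneg _))
      rw [mul_pow]
      calc _ ≤ ‖N (jac x a w₀ v)‖ ^ 2 * (lam0 x / 500 * ‖v‖ ^ 2) := by gcongr
        _ = (9 / 10 * lam0 x * ‖N (jac x a w₀ v)‖ ^ 2) * (1 / 450 * ‖v‖ ^ 2) := by ring
        _ ≤ ‖v‖ ^ 2 * (1 / 450 * ‖v‖ ^ 2) := by gcongr
        _ ≤ _ := by nlinarith [sq_nonneg (‖v‖ ^ 2)]
    have h5 : inner ℝ (N (jac x a w₀ v)) (jac x a w v) = inner ℝ (N (jac x a w₀ v)) (jac x a w₀ v)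
        + inner ℝ (N (jac x a w₀ v)) (jac x a w v - jac x a w₀ v) := by
      rw [← inner_add_right]; simp
    have h6 := real_inner_le_norm (N (jac x a w₀ v)) (jac x a w v - jac x a w₀ v)
    simp only [LinearMap.comp_apply]
    rw [h5]
    linarith [hN4 v]
  · have h1 : N (jac x a w₀ (jacT x a w u)) - u =
        N (jac x a w₀ (jacT x a w u - jacT x a w₀ u)) := by
      rw [map_sub, map_sub, hN1]
    have h2 := hN2 (jac x a w₀ (jacT x a w u - jacT x a w₀ u))
    have h3 := norm_jac_jacT_sub_le hx h.sign hw u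
    have h4 : n * nearFrac x R w₀ * ‖u‖ ≤ lam0 x / 500 * ‖u‖ :=
      mul_le_mul_of_nonneg_right h.near_le (norm_nonneg _)
    simp only [LinearMap.comp_apply]
    rw [h1]
    have h5 : lam0 x * (9 / 10 * ‖N (jac x a w₀ (jacT x a w u - jacT x a w₀ u))‖) ≤
        lam0 x * (1 / 500 * ‖u‖) := by linarith
    have h6 := le_of_mul_le_mul_left h5 hl
    linarith [norm_nonneg u]

lemma norm_sq_jac_le (h : GoodInit x y R a w₀) (hn : 0 < n) (hx : ∀ i, ‖x i‖ = 1)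
    (hl : 0 < lam0 x) (hM : 0 ≤ lamM x) (hw : ∀ r, ‖w r - w₀ r‖ ≤ R) (v : State m d) :
    ‖jac x a w v‖ ^ 2 ≤ lamM x * ‖v‖ ^ 2 := by
  refine norm_sq_le_of_transpose (D := jacT x a w) (Dt := jac x a w)
    (fun u v => by rw [real_inner_comm, ← inner_jacT, real_inner_comm]) hM (fun u => ?_) v
  have h1 : ‖jacT x a w u - jacT x a w₀ u‖ ^ 2 ≤ nearFrac x R w₀ * ‖u‖ ^ 2 :=
    norm_sq_le_of_transpose (D := fun v => jac x a w v - jac x a w₀ v)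
      (Dt := fun u => jacT x a w u - jacT x a w₀ u)
      (fun u v => by rw [inner_sub_left, inner_sub_right, inner_jacT, inner_jacT])
      nearFrac_nonneg (norm_sq_jac_sub_le hx h.sign hw) u
  have h2 : ‖jacT x a w u‖ ^ 2 = ‖jacT x a w₀ u‖ ^ 2
      + 2 * inner ℝ u (jac x a w₀ (jacT x a w u - jacT x a w₀ u))
      + ‖jacT x a w u - jacT x a w₀ u‖ ^ 2 := by
    rw [← inner_jacT, ← norm_add_sq_real]; simp
  have h3 : inner ℝ u (jac x a w₀ (jacT x a w u - jacT x a w₀ u)) ≤ lam0 x / 500 * ‖u‖ ^ 2 := by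
    calc _ ≤ ‖u‖ * (n * nearFrac x R w₀ * ‖u‖) := (real_inner_le_norm _ _).trans
          (mul_le_mul_of_nonneg_left (norm_jac_jacT_sub_le hx h.sign hw u) (norm_nonneg _))
      _ = n * nearFrac x R w₀ * ‖u‖ ^ 2 := by ring
      _ ≤ _ := mul_le_mul_of_nonneg_right h.near_le (sq_nonneg _)
  have h4 := (h.norm_sq_jacT_bounds hl u).2
  have h5 : nearFrac x R w₀ * ‖u‖ ^ 2 ≤ lam0 x / 500 * ‖u‖ ^ 2 :=
    mul_le_mul_of_nonneg_right (h.nearFrac_le hn) (sq_nonneg _)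
  unfold lamM
  nlinarith [mul_nonneg hl.le (sq_nonneg ‖u‖)]

end GoodInit

/-- Both gradient corrections are a multiple `κ ∈ {0, 1}` of `Jᵀ J v` up to an error of relative
size `n / m`. -/
lemma exists_curvature_split (hx : ∀ i, ‖x i‖ = 1) (ha : ∀ r, |a r| = 1)
    {K : Weights m d → Weights m d → Weights m d} (hK : K = hessBlock x a ∨ K = hessFull x a) :
    ∃ (κ : ℝ) (e : Weights m d → Weights m d → Weights m d), (κ = 0 ∨ κ = 1) ∧
      ∀ w v r, K w v r = κ • jacT x a w (jac x a w (WithLp.toLp 2 v)) r + e w v r ∧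
        ‖e w v r‖ ≤ (n : ℝ) / m * ‖v r‖ := by
  rcases hK with rfl | rfl
  · exact ⟨0, hessBlock x a, Or.inl rfl, fun w v r =>
      ⟨by simp, norm_hessBlock_le hx ha v r⟩⟩
  · refine ⟨1, 0, Or.inr rfl, fun w v r => ⟨?_, ?_⟩⟩
    · simp [hessFull]
    · simp only [Pi.zero_apply, norm_zero]; positivity

end Convergence

section Trajectory

variable {n d m : ℕ} {x : Fin n → Vec d} {y : Fin n → ℝ} {a : Fin m → ℝ} {w₀ : Weights m d}
  {R s T : ℝ} {K : Weights m d → Weights m d → Weights m d} {W V : ℝ → Weights m d}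

lemma spectrum_gramInf_nonempty (hn : 0 < n) : (spectrum ℝ (gramInf x)).Nonempty := by
  rw [(isHermitian_gramInf (x := x)).spectrum_real_eq_range_eigenvalues]
  exact ⟨_, ⟨0, hn⟩, rfl⟩

lemma lam0_le_lamM (hn : 0 < n) : 5 / 4 * lam0 x ≤ lamM x := by
  have hfin : (spectrum ℝ (gramInf x)).Finite := Matrix.finite_real_spectrum
  have := csInf_le_csSup (spectrum_gramInf_nonempty (x := x) hn)
    hfin.bddBelow hfin.bddAbove
  unfold lamM
  have h : lam0 x ≤ sSup (spectrum ℝ (gramInf x)) := this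
  linarith

/-- While no neuron has moved by more than `R`, velocity and residual decay at rate
`3/4 · √(λ₀/2)`. -/
lemma norm_sq_le_of_near (hn : 0 < n) (hx : ∀ i, ‖x i‖ = 1) (hl : 0 < lam0 x)
    (hs : 0 < s) (hsM : s * lam0 x ≤ 2) (hG : GoodInit x y R a w₀)
    (hK : K = hessBlock x a ∨ K = hessFull x a) (h : IsNAGSolution x y a K s T W V) (hT : 0 ≤ T)
    (hW : W 0 = w₀) (hnear : ∀ t ∈ Set.Icc 0 T, ∀ r, ‖W t r - w₀ r‖ ≤ R) :
    ‖(WithLp.toLp 2 (V T) : State m d)‖ ^ 2 ≤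
      5 * ‖(WithLp.toLp 2 (residual x y a w₀) : EuclideanSpace ℝ (Fin n))‖ ^ 2
        * Real.exp (-(3 / 4 * √(lam0 x / 2) * T)) ∧
    ‖(WithLp.toLp 2 (residual x y a (W T)) : EuclideanSpace ℝ (Fin n))‖ ^ 2 ≤
      5 * ‖(WithLp.toLp 2 (residual x y a w₀) : EuclideanSpace ℝ (Fin n))‖ ^ 2
        * Real.exp (-(3 / 4 * √(lam0 x / 2) * T)) := by
  set γ := √(lam0 x / 2) with hγ
  have hγ0 : 0 < γ := Real.sqrt_pos.2 (by positivity)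
  have hγ2 : γ ^ 2 = lam0 x / 2 := Real.sq_sqrt (by positivity)
  set σ := √s with hσ
  have hσ0 : 0 < σ := Real.sqrt_pos.2 hs
  have hσ2 : σ ^ 2 = s := Real.sq_sqrt hs.le
  have hγσ : γ * σ ≤ 1 := by
    refine le_of_sq_le_sq ?_ zero_le_one
    rw [mul_pow, hγ2, hσ2]; linarith
  have hc : √(2 * lam0 x) = 2 * γ := by
    rw [show 2 * lam0 x = (2 * γ) ^ 2 by rw [mul_pow, hγ2]; ring, Real.sqrt_sq (by positivity)]
  have hb : √(lam0 x * s / 2) = γ * σ := by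
    rw [hγ, hσ, ← Real.sqrt_mul (by positivity)]; congr 1; ring
  obtain ⟨A, hA, hAw⟩ := hG.exists_pseudoInverse hn hx hl
  obtain ⟨κ, e, hκ, he⟩ := exists_curvature_split hx hG.sign hK
  have key := h.energy_le hT A γ (1 + γ * σ) (3 / 4 * γ) (by
    intro t ht v v' z hv hv' hz
    obtain ⟨hAJ, hAJt⟩ := hAw (W t) (hnear t ht)
    have he_norm : ‖(WithLp.toLp 2 (e (W t) (V t)) : State m d)‖ ≤ (n : ℝ) / m * ‖v‖ := by
      refine le_of_sq_le_sq ?_ (by positivity)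
      rw [hv, mul_pow, PiLp.norm_sq_eq_of_L2, PiLp.norm_sq_eq_of_L2, Finset.mul_sum]
      refine Finset.sum_le_sum fun r _ => ?_
      rw [← mul_pow]
      exact pow_le_pow_left₀ (norm_nonneg _) (he _ _ r).2 2
    refine energy_deriv_le (σ := σ) (κ := κ) (e := -(σ • WithLp.toLp 2 (e (W t) (V t))))
      (inner_jacT x a (W t)) hγ0 hσ0.le hκ rfl hA (hAJ v) hAJt ?_ ?_
    · rw [norm_neg, norm_smul, Real.norm_of_nonneg hσ0.le]
      have hw : (n : ℝ) / m ≤ γ ^ 2 / 20 := by rw [hγ2]; linarith [hG.width]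
      calc _ ≤ σ * (γ ^ 2 / 20 * ‖v‖) := by
            gcongr
            exact he_norm.trans (mul_le_mul_of_nonneg_right hw (norm_nonneg _))
        _ = γ * σ * (γ / 20 * ‖v‖) := by ring
        _ ≤ 1 * (γ / 20 * ‖v‖) := by gcongr
        _ = _ := by ring
    · rw [hv', hv, hz]
      ext1 r
      simp only [accel, PiLp.add_apply, PiLp.sub_apply, PiLp.neg_apply, PiLp.smul_apply, map_add,
        map_smul, (he (W t) (V t) r).1, hc, hb, neg_smul]
      change -((2 * γ) • V t r + σ • (κ • _ + _) + (1 + γ * σ) • jacT x a (W t)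
        (WithLp.toLp 2 (residual x y a (W t))) r) = _
      rw [smul_add, smul_smul, mul_comm σ κ]
      abel)
  have h0 : energy A γ (1 + γ * σ) (WithLp.toLp 2 (V 0)) (WithLp.toLp 2 (residual x y a (W 0))) ≤
      ‖(WithLp.toLp 2 (residual x y a w₀) : EuclideanSpace ℝ (Fin n))‖ ^ 2 := by
    rw [h.init_velocity, hW]
    simp only [energy, WithLp.toLp_zero, norm_zero, map_zero, inner_zero_left]
    nlinarith [sq_nonneg ‖(WithLp.toLp 2 (residual x y a w₀) : EuclideanSpace ℝ (Fin n))‖]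
  have h1 := energy_lower (b := 1 + γ * σ) hγ0.le (by nlinarith)
    (WithLp.toLp 2 (residual x y a (W T))) (hA (WithLp.toLp 2 (V T)))
  have h2 := key.trans (mul_le_mul_of_nonneg_right h0 (Real.exp_pos _).le)
  constructor <;> linarith [h1.1, h1.2]

/-- The finite-travel estimate: while no neuron has moved by more than `R`, the exponential decay
keeps the integrated force on every neuron of order `‖Δ(0)‖ √(n/m) / γ` with `γ = √(λ₀/2)`, and the
friction `2γ` turns this into a bound on the displacement. -/
lemma norm_travel_le (hn : 0 < n) (hx : ∀ i, ‖x i‖ = 1) (hl : 0 < lam0 x)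
    (hs : 0 < s) (hsM : s * lamM x ≤ 2) (hG : GoodInit x y R a w₀)
    (hK : K = hessBlock x a ∨ K = hessFull x a) (h : IsNAGSolution x y a K s T W V) (hT : 0 ≤ T)
    (hW : W 0 = w₀) (hnear : ∀ t ∈ Set.Icc 0 T, ∀ r, ‖W t r - w₀ r‖ ≤ R) (r : Fin m) :
    ‖W T r - w₀ r‖ ≤ 27 * √((n : ℝ) / m) *
      ‖(WithLp.toLp 2 (residual x y a w₀) : EuclideanSpace ℝ (Fin n))‖ / lam0 x := by
  have hM := lam0_le_lamM (x := x) hn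
  have hM0 : 0 ≤ lamM x := by linarith
  have hsl : s * lam0 x ≤ 2 := by nlinarith
  set γ := √(lam0 x / 2) with hγ
  have hγ0 : 0 < γ := Real.sqrt_pos.2 (by positivity)
  have hγ2 : γ ^ 2 = lam0 x / 2 := Real.sq_sqrt (by positivity)
  set σ := √s with hσ
  have hσ0 : 0 < σ := Real.sqrt_pos.2 hs
  have hσ2 : σ ^ 2 = s := Real.sq_sqrt hs.le
  have hγσ : γ * σ ≤ 1 := by
    refine le_of_sq_le_sq ?_ zero_le_one
    rw [mul_pow, hγ2, hσ2]; linarith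
  have hc : √(2 * lam0 x) = 2 * γ := by
    rw [show 2 * lam0 x = (2 * γ) ^ 2 by rw [mul_pow, hγ2]; ring, Real.sqrt_sq (by positivity)]
  have hb : √(lam0 x * s / 2) = γ * σ := by
    rw [hγ, hσ, ← Real.sqrt_mul (by positivity)]; congr 1; ring
  set D := ‖(WithLp.toLp 2 (residual x y a w₀) : EuclideanSpace ℝ (Fin n))‖ with hD
  have hD0 : 0 ≤ D := norm_nonneg _
  set q := √((n : ℝ) / m) with hq
  have hq0 : 0 ≤ q := Real.sqrt_nonneg _
  have hq2 : q ^ 2 = (n : ℝ) / m := Real.sq_sqrt (by positivity)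
  have hσq : σ * q ≤ 1 := by
    have hqγ : q ≤ γ := by
      refine le_of_sq_le_sq ?_ hγ0.le
      rw [hq2, hγ2]; linarith [hG.width]
    calc σ * q ≤ σ * γ := by gcongr
      _ ≤ 1 := by rw [mul_comm]; exact hγσ
  -- velocity and residual at intermediate times
  have hdecay : ∀ t ∈ Set.Icc 0 T,
      ‖(WithLp.toLp 2 (V t) : State m d)‖ ≤ 9 / 4 * D * Real.exp (-(3 / 8 * γ * t)) ∧
      ‖(WithLp.toLp 2 (residual x y a (W t)) : EuclideanSpace ℝ (Fin n))‖ ≤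
        9 / 4 * D * Real.exp (-(3 / 8 * γ * t)) := fun t ht => by
    have h1 := norm_sq_le_of_near hn hx hl hs hsl hG hK (h.restrict ht.2) ht.1 hW
      fun τ hτ => hnear τ ⟨hτ.1, hτ.2.trans ht.2⟩
    have h2 : 5 * D ^ 2 * Real.exp (-(3 / 4 * γ * t)) ≤
        (9 / 4 * D * Real.exp (-(3 / 8 * γ * t))) ^ 2 := by
      rw [mul_pow, mul_pow, sq (Real.exp _), ← Real.exp_add,
        show -(3 / 8 * γ * t) + -(3 / 8 * γ * t) = -(3 / 4 * γ * t) by ring]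
      gcongr
      norm_num
    exact ⟨le_of_sq_le_sq (h1.1.trans h2) (by positivity),
      le_of_sq_le_sq (h1.2.trans h2) (by positivity)⟩
  obtain ⟨κ, e, hκ, he⟩ := exists_curvature_split hx hG.sign hK
  have hforce : ∀ t ∈ Set.Icc 0 T,
      ‖accel x y a K s (W t) (V t) r + (2 * γ) • V t r‖ ≤
        81 / 8 * q * D * Real.exp (-(3 / 8 * γ * t)) := fun t ht => by
    obtain ⟨h1, h2⟩ := hdecay t ht
    set E := Real.exp (-(3 / 8 * γ * t))
    set v : State m d := WithLp.toLp 2 (V t)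
    set z : EuclideanSpace ℝ (Fin n) := WithLp.toLp 2 (residual x y a (W t))
    have h3 : accel x y a K s (W t) (V t) r + (2 * γ) • V t r =
        -(jacT x a (W t) ((κ * σ) • jac x a (W t) v + (1 + γ * σ) • z) r
          + σ • e (W t) (V t) r) := by
      simp only [accel, hc, hb, (he (W t) (V t) r).1, map_add, map_smul, PiLp.add_apply,
        PiLp.smul_apply]
      change -((2 * γ) • V t r + σ • (κ • jacT x a (W t) (jac x a (W t) v) r + _)
        + (1 + γ * σ) • jacT x a (W t) z r) + _ = _
      rw [smul_add, smul_smul, mul_comm σ κ]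
      abel
    have hJv : σ * ‖jac x a (W t) v‖ ≤ 3 / 2 * ‖v‖ := by
      refine le_of_sq_le_sq ?_ (by positivity)
      rw [mul_pow, hσ2]
      calc _ ≤ s * (lamM x * ‖v‖ ^ 2) := by
            gcongr; exact hG.norm_sq_jac_le hn hx hl hM0 (hnear t ht) v
        _ = s * lamM x * ‖v‖ ^ 2 := by ring
        _ ≤ 2 * ‖v‖ ^ 2 := by gcongr
        _ ≤ _ := by nlinarith [sq_nonneg ‖v‖]
    have h4 : ‖(κ * σ) • jac x a (W t) v + (1 + γ * σ) • z‖ ≤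
        κ * (3 / 2 * ‖v‖) + 2 * ‖z‖ := by
      have hκ0 : 0 ≤ κ := by rcases hκ with h | h <;> simp [h]
      refine (norm_add_le _ _).trans (add_le_add ?_ ?_)
      · rw [norm_smul, Real.norm_of_nonneg (by positivity), mul_assoc]
        gcongr
      · rw [norm_smul, Real.norm_of_nonneg (by positivity)]
        gcongr
        linarith
    have h5 : ‖σ • e (W t) (V t) r‖ ≤ q * ‖v‖ := by
      rw [norm_smul, Real.norm_of_nonneg hσ0.le]
      calc _ ≤ σ * (q ^ 2 * ‖v‖) := by
            rw [hq2]
            gcongr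
            exact (he _ _ r).2.trans (mul_le_mul_of_nonneg_left (PiLp.norm_apply_le v r)
              (by positivity))
        _ = σ * q * (q * ‖v‖) := by ring
        _ ≤ 1 * (q * ‖v‖) := by gcongr
        _ = _ := one_mul _
    have hκ' : κ * (3 / 2 * ‖v‖) ≤ 1 * (3 / 2 * ‖v‖) :=
      mul_le_mul_of_nonneg_right (by rcases hκ with h | h <;> simp [h]) (by positivity)
    rw [h3, norm_neg]
    calc _ ≤ q * (κ * (3 / 2 * ‖v‖) + 2 * ‖z‖) + q * ‖v‖ := by
          refine (norm_add_le _ _).trans (add_le_add ?_ h5)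
          exact (norm_jacT_apply_le hx hG.sign _ r).trans (mul_le_mul_of_nonneg_left h4 hq0)
      _ ≤ q * (1 * (3 / 2 * ‖v‖) + 2 * ‖z‖) + q * ‖v‖ := by gcongr
      _ = q * (5 / 2 * ‖v‖ + 2 * ‖z‖) := by ring
      _ ≤ q * (5 / 2 * (9 / 4 * D * E) + 2 * (9 / 4 * D * E)) := by gcongr
      _ ≤ _ := by
        have : 0 ≤ q * (D * E) := by positivity
        linarith
  have hbound : ∀ t ∈ Set.Icc 0 T, ‖V t r + (2 * γ) • (W t r - w₀ r)‖ ≤ 27 * q * D / γ :=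
    fun t ht => by
    have h1 : V t r + (2 * γ) • (W t r - w₀ r) =
        ∫ τ in (0 : ℝ)..t, (accel x y a K s (W τ) (V τ) r + (2 * γ) • V τ r) := by
      have h' := h.restrict ht.2
      have hi : IntervalIntegrable (fun τ => (2 * γ) • V τ r) volume 0 t :=
        (h'.intervalIntegrable_velocity ht.1 r).smul (2 * γ)
      rw [intervalIntegral.integral_add (h'.intervalIntegrable_accel ht.1 r) hi, intervalIntegral.integral_smul,
        h.velocity_eq r ht, h.weight_eq r ht, h.init_velocity, hW]
      simp
    rw [h1]
    refine (intervalIntegral.norm_integral_le_of_norm_le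
      (g := fun τ => 81 / 8 * q * D * Real.exp (-(3 / 8 * γ * τ))) ht.1
      (Filter.Eventually.of_forall fun τ hτ => hforce τ ⟨hτ.1.le, hτ.2.trans ht.2⟩)
      (Continuous.intervalIntegrable (by fun_prop) _ _)).trans ?_
    rw [intervalIntegral.integral_const_mul]
    calc _ ≤ 81 / 8 * q * D * (1 / (3 / 8 * γ)) := by
          gcongr; exact integral_exp_neg_le (by positivity) t
      _ = _ := by field_simp; ring
  have h6 := norm_le_of_norm_deriv_add_le (D := fun t => W t r - w₀ r) (V := fun t => V t r)
    (c := 2 * γ) (by positivity) (by simp [hW])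
    (fun t ht => (h.hasDeriv t ht r).sub_const _) hbound (t := T) ⟨hT, le_rfl⟩
  refine h6.trans_eq ?_
  rw [show lam0 x = 2 * γ ^ 2 by rw [hγ2]; ring]
  field_simp

/-- From a good initialization the loss decays exponentially: at the first time at which some
neuron is at distance `R` from its start, the travel estimate would place it strictly closer. -/
theorem GoodInit.loss_le (hG : GoodInit x y R a w₀) (hn : 0 < n) (hx : ∀ i, ‖x i‖ = 1)
    (hl : 0 < lam0 x) (hs : 0 < s) (hsM : s * lamM x ≤ 2)
    (hK : K = hessBlock x a ∨ K = hessFull x a) (h : IsNAGSolution x y a K s T W V)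
    (hW : W 0 = w₀) {t : ℝ} (ht : t ∈ Set.Icc 0 T) :
    loss x y a (W t) ≤ 26 * pseudoLoss x y a (W 0) / (3 * lam0 x) *
      Real.exp (-(3 / 4 * √(lam0 x / 2) * t)) := by
  have hM := lam0_le_lamM (x := x) hn
  have hT : 0 ≤ T := ht.1.trans ht.2
  have hR := hG.radius_pos hl
  have hcont : ContinuousOn (fun t r => W t r - w₀ r) (Set.Icc 0 T) :=
    continuousOn_pi.2 fun r => (fun t ht => (h.hasDeriv t ht r).continuousWithinAt.sub
      continuousWithinAt_const)
  have hnear : ∀ t ∈ Set.Icc 0 T, ∀ r, ‖W t r - w₀ r‖ ≤ R := by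
    by_contra hcon
    push Not at hcon
    obtain ⟨t₁, ht₁, r₁, hr₁⟩ := hcon
    -- the first time `t₀` at which some neuron is at distance at least `R`
    have hcompact : IsCompact (Set.Icc 0 T ∩ {t | R ≤ ‖fun r => W t r - w₀ r‖}) :=
      isCompact_Icc.of_isClosed_subset
        (hcont.norm.preimage_isClosed_of_isClosed isClosed_Icc isClosed_Ici) Set.inter_subset_left
    obtain ⟨t₀, ⟨ht₀, hRt₀⟩, hmin⟩ := hcompact.exists_isLeast
      ⟨t₁, ht₁, hr₁.le.trans (norm_le_pi_norm (fun r => W t₁ r - w₀ r) r₁)⟩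
    have hsub : Set.Icc 0 t₀ ⊆ Set.Icc 0 T := Set.Icc_subset_Icc_right ht₀.2
    have h0 : ‖fun r => W 0 r - w₀ r‖ ≤ R :=
      (pi_norm_le_iff_of_nonneg hR.le).2 fun r => by simp [hW, hR.le]
    obtain ⟨t₂, ht₂, heq⟩ := intermediate_value_Icc ht₀.1 (hcont.norm.mono hsub)
      (show R ∈ Set.Icc _ _ from ⟨h0, hRt₀⟩)
    have ht₂₀ : t₂ = t₀ := le_antisymm ht₂.2 (hmin ⟨hsub ht₂, heq.ge⟩)
    rw [ht₂₀] at heq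
    have hle : ∀ τ ∈ Set.Icc 0 t₀, ∀ r, ‖W τ r - w₀ r‖ ≤ R := fun τ hτ r => by
      refine (norm_le_pi_norm (fun r => W τ r - w₀ r) r).trans ?_
      rcases hτ.2.eq_or_lt with rfl | hlt
      · exact heq.le
      · by_contra hgt
        exact absurd (hmin ⟨hsub hτ, (not_le.1 hgt).le⟩) (not_le.2 hlt)
    have hlt : ‖fun r => W t₀ r - w₀ r‖ < R :=
      (pi_norm_lt_iff hR).2 fun r => lt_of_le_of_lt
        (norm_travel_le hn hx hl hs hsM hG hK (h.restrict ht₀.2) ht₀.1 hW hle r) hG.travel_lt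
    exact absurd heq hlt.ne
  have h1 := (norm_sq_le_of_near hn hx hl hs (by nlinarith) hG hK (h.restrict ht.2) ht.1 hW
    fun τ hτ => hnear τ ⟨hτ.1, hτ.2.trans ht.2⟩).2
  have h2 := (hG.norm_sq_jacT_bounds hl (WithLp.toLp 2 (residual x y a w₀))).1
  rw [loss_eq, pseudoLoss_eq, hW]
  have hE := Real.exp_pos (-(3 / 4 * √(lam0 x / 2) * t))
  set D := ‖(WithLp.toLp 2 (residual x y a w₀) : EuclideanSpace ℝ (Fin n))‖ ^ 2
  have h3 : 5 / 2 * D ≤ 26 * (1 / 2 *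
      ‖jacT x a w₀ (WithLp.toLp 2 (residual x y a w₀))‖ ^ 2) / (3 * lam0 x) := by
    rw [le_div_iff₀ (by positivity)]
    have : 0 ≤ D := sq_nonneg _
    nlinarith
  calc _ ≤ 5 / 2 * D * Real.exp (-(3 / 4 * √(lam0 x / 2) * t)) := by linarith
    _ ≤ _ := by gcongr

end Trajectory

/-! ### Positivity of the limiting kernel -/

section Positivity

variable {n d : ℕ} {x : Fin n → Vec d}

instance isOpenPosMeasure_stdGaussian : (stdGaussian (Vec d)).IsOpenPosMeasure := by
  have : (gaussianReal 0 1).IsOpenPosMeasure :=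
    (gaussianReal_absolutelyContinuous' 0 one_ne_zero).isOpenPosMeasure
  refine ⟨fun U hU hne => ?_⟩
  have hcont : Continuous (fun v : Fin (Module.finrank ℝ (Vec d)) → ℝ =>
    ∑ i, v i • stdOrthonormalBasis ℝ (Vec d) i) := by fun_prop
  rw [stdGaussian, Measure.map_apply hcont.measurable hU.measurableSet]
  obtain ⟨w, hw⟩ := hne
  refine (hU.preimage hcont).measure_ne_zero _ ⟨fun i => inner ℝ (stdOrthonormalBasis ℝ _ i) w, ?_⟩
  simpa only [Set.mem_preimage, (stdOrthonormalBasis ℝ (Vec d)).sum_repr'] using hw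

lemma measurableSet_halfspace (z : Vec d) : MeasurableSet {w : Vec d | 0 ≤ (inner ℝ w z : ℝ)} :=
  measurableSet_le measurable_const (by fun_prop)

/-- The feature `∑_i u_i 𝟙{⟪w, x_i⟫ ≥ 0} x_i` of a coefficient vector `u`. -/
noncomputable def feature (x : Fin n → Vec d) (u : Fin n → ℝ) (w : Vec d) : Vec d :=
  ∑ i, if 0 ≤ (inner ℝ w (x i) : ℝ) then u i • x i else 0

lemma integrable_indicator_pair (z z' : Vec d) (c : ℝ) :
    Integrable (fun w : Vec d => if 0 ≤ (inner ℝ w z : ℝ) ∧ 0 ≤ (inner ℝ w z' : ℝ) then c else 0)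
      (stdGaussian (Vec d)) := by
  have h := ((measurableSet_halfspace z).inter (measurableSet_halfspace z'))
  exact ((integrable_const c).indicator h).congr (Filter.Eventually.of_forall fun w => by
    simp only [Set.indicator, Set.mem_inter_iff, Set.mem_ofPred_eq])

lemma norm_sq_feature (u : Fin n → ℝ) (w : Vec d) :
    ‖feature x u w‖ ^ 2 = ∑ i, ∑ j, u i * (if 0 ≤ (inner ℝ w (x i) : ℝ) ∧
      0 ≤ (inner ℝ w (x j) : ℝ) then (inner ℝ (x i) (x j) : ℝ) else 0) * u j := by
  rw [← real_inner_self_eq_norm_sq, feature, sum_inner]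
  refine Finset.sum_congr rfl fun i _ => ?_
  rw [inner_sum]
  refine Finset.sum_congr rfl fun j _ => ?_
  by_cases hi : 0 ≤ (inner ℝ w (x i) : ℝ) <;> by_cases hj : 0 ≤ (inner ℝ w (x j) : ℝ) <;>
    simp [hi, hj, inner_smul_left, inner_smul_right]
  ring

lemma integrable_norm_sq_feature (u : Fin n → ℝ) :
    Integrable (fun w => ‖feature x u w‖ ^ 2) (stdGaussian (Vec d)) := by
  simp only [norm_sq_feature]
  exact integrable_finsetSum _ fun i _ => integrable_finsetSum _ fun j _ =>
    ((integrable_indicator_pair _ _ _).const_mul _).mul_const _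

lemma quadForm_gramInf_eq (u : Fin n → ℝ) :
    ∑ i, ∑ j, u i * gramInf x i j * u j = ∫ w, ‖feature x u w‖ ^ 2 ∂(stdGaussian (Vec d)) := by
  have hi : ∀ i j, Integrable (fun w : Vec d => u i * (if 0 ≤ (inner ℝ w (x i) : ℝ) ∧
      0 ≤ (inner ℝ w (x j) : ℝ) then (inner ℝ (x i) (x j) : ℝ) else 0) * u j)
      (stdGaussian (Vec d)) := fun i j =>
    ((integrable_indicator_pair _ _ _).const_mul _).mul_const _
  simp only [norm_sq_feature]
  rw [integral_finsetSum _ fun i _ => integrable_finsetSum _ fun j _ => hi i j]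
  refine Finset.sum_congr rfl fun i _ => ?_
  rw [integral_finsetSum _ fun j _ => hi i j]
  refine Finset.sum_congr rfl fun j _ => ?_
  rw [integral_mul_const, integral_const_mul]
  rfl

/-- If no two inputs are parallel, the boundary hyperplane of `x_i` contains a point off all the
other boundary hyperplanes. -/
lemma exists_boundary_point (hx : ∀ i, ‖x i‖ = 1)
    (hli : ∀ i j, i ≠ j → LinearIndependent ℝ ![x i, x j]) (i : Fin n) :
    ∃ w : Vec d, (inner ℝ w (x i) : ℝ) = 0 ∧ ∀ j, j ≠ i → (inner ℝ w (x j) : ℝ) ≠ 0 := by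
  have hz : ∀ j : {j // j ≠ i}, x j - (inner ℝ (x i) (x j) : ℝ) • x i ≠ 0 := fun j h0 => by
    have := (LinearIndependent.pair_iff.1 (hli i j j.2.symm)) (-(inner ℝ (x i) (x j) : ℝ)) 1
      (by rw [neg_smul, one_smul, neg_add_eq_sub]; exact h0)
    exact one_ne_zero this.2
  obtain ⟨f, hf⟩ := Module.exists_dual_forall_apply_ne_zero (K := ℝ) _ hz
  set w := (InnerProductSpace.toDual ℝ (Vec d)).symm f.toContinuousLinearMap with hw
  have hfw : ∀ z, (inner ℝ w z : ℝ) = f z := fun z => by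
    rw [hw, InnerProductSpace.toDual_symm_apply]; rfl
  refine ⟨w - (inner ℝ w (x i) : ℝ) • x i, ?_, fun j hj => ?_⟩
  · rw [inner_sub_left, inner_smul_left, real_inner_self_eq_norm_sq, hx]; simp
  · have h1 := hf ⟨j, hj⟩
    rw [← hfw, inner_sub_right, inner_smul_right] at h1
    rw [inner_sub_left, inner_smul_left]
    simp only [conj_trivial]
    intro h2
    exact h1 (by linarith)

/-- The features of the inputs are linearly independent in `L²` of the Gaussian: across a boundary
point of `x_i` only the `i`-th activation jumps. -/
lemma integral_norm_sq_feature_pos (hx : ∀ i, ‖x i‖ = 1)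
    (hli : ∀ i j, i ≠ j → LinearIndependent ℝ ![x i, x j]) {u : Fin n → ℝ} {i : Fin n}
    (hu : u i ≠ 0) : 0 < ∫ w, ‖feature x u w‖ ^ 2 ∂(stdGaussian (Vec d)) := by
  rcases (integral_nonneg (μ := stdGaussian (Vec d))
    (f := fun w => ‖feature x u w‖ ^ 2) fun w => sq_nonneg _).eq_or_lt' with h0 | hpos
  swap
  · exact hpos
  exfalso
  rw [integral_eq_zero_iff_of_nonneg (fun w => sq_nonneg _) (integrable_norm_sq_feature u)] at h0
  obtain ⟨w₀, hi, hj⟩ := exists_boundary_point hx hli i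
  -- the two sides, for `c = 1` and `c = -1`, of the boundary of `x_i` near `w₀`
  have key : ∀ c : ℝ, c ≠ 0 → ∃ w : Vec d, feature x u w = 0 ∧ 0 < c * (inner ℝ w (x i) : ℝ) ∧
      ∀ j, j ≠ i → 0 < (inner ℝ w₀ (x j) : ℝ) * (inner ℝ w (x j) : ℝ) := by
    intro c hc
    let U : Set (Vec d) := {w | 0 < c * (inner ℝ w (x i) : ℝ)} ∩
      ⋂ j : {j // j ≠ i}, {w | 0 < (inner ℝ w₀ (x j) : ℝ) * (inner ℝ w (x j) : ℝ)}
    have hU : IsOpen U := by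
      refine (isOpen_lt continuous_const (by fun_prop)).inter (isOpen_iInter_of_finite fun j => ?_)
      exact isOpen_lt continuous_const (by fun_prop)
    have hne : U.Nonempty := by
      have hev : ∀ᶠ ε : ℝ in nhdsWithin 0 (Set.Ioi 0), ∀ j : {j // j ≠ i},
          0 < (inner ℝ w₀ (x j) : ℝ) * (inner ℝ (w₀ + (ε * c) • x i) (x j) : ℝ) := by
        rw [Filter.eventually_all]
        intro j
        have hc1 : Continuous fun ε : ℝ =>
            (inner ℝ w₀ (x j) : ℝ) * (inner ℝ (w₀ + (ε * c) • x i) (x j) : ℝ) := by fun_prop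
        refine (hc1.continuousAt.eventually_const_lt ?_).filter_mono nhdsWithin_le_nhds
        simpa using hj j j.2
      obtain ⟨ε, hε, hε0⟩ := (hev.and self_mem_nhdsWithin).exists
      refine ⟨w₀ + (ε * c) • x i, ?_, Set.mem_iInter.2 hε⟩
      have : (0 : ℝ) < ε := hε0
      rw [Set.mem_ofPred_eq, inner_add_left, hi, inner_smul_left, real_inner_self_eq_norm_sq, hx]
      simp only [conj_trivial, zero_add, one_pow, mul_one]
      have := mul_pos this (mul_self_pos.2 hc)
      linarith
    by_contra hcon
    push Not at hcon
    refine hU.measure_ne_zero (stdGaussian (Vec d)) hne (measure_mono_null (fun w hw => ?_) h0)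
    intro h
    obtain ⟨j, hji, hle⟩ := hcon w (by simpa using h) hw.1
    exact absurd (Set.mem_iInter.1 hw.2 ⟨j, hji⟩) (not_lt.2 hle)
  obtain ⟨w₁, h1, hi1, hj1⟩ := key 1 one_ne_zero
  obtain ⟨w₂, h2, hi2, hj2⟩ := key (-1) (by norm_num)
  have hsub : feature x u w₁ - feature x u w₂ = u i • x i := by
    rw [feature, feature, ← Finset.sum_sub_distrib, Finset.sum_eq_single_of_mem i (Finset.mem_univ i)]
    · rw [if_pos (by linarith), if_neg (by linarith), sub_zero]
    · intro j _ hji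
      have h3 := hj1 j hji
      have h4 := hj2 j hji
      have h5 : 0 ≤ (inner ℝ w₁ (x j) : ℝ) ↔ 0 ≤ (inner ℝ w₂ (x j) : ℝ) := by
        rcases lt_or_gt_of_ne (hj j hji) with h | h
        · exact ⟨fun h6 => absurd h3 (not_lt.2 (mul_nonpos_of_nonpos_of_nonneg h.le h6)),
            fun h6 => absurd h4 (not_lt.2 (mul_nonpos_of_nonpos_of_nonneg h.le h6))⟩
        · exact ⟨fun _ => ((mul_pos_iff_of_pos_left h).1 h4).le,
            fun _ => ((mul_pos_iff_of_pos_left h).1 h3).le⟩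
      simp only [h5, sub_self]
  rw [h1, h2, sub_zero, eq_comm, smul_eq_zero] at hsub
  rcases hsub with h | h
  · exact hu h
  · have := hx i; rw [h, norm_zero] at this; exact zero_ne_one this

lemma lam0_pos (hn : 0 < n) (hx : ∀ i, ‖x i‖ = 1)
    (hli : ∀ i j, i ≠ j → LinearIndependent ℝ ![x i, x j]) : 0 < lam0 x := by
  have hpd : (gramInf x).PosDef := by
    refine Matrix.posDef_iff_dotProduct_mulVec.2 ⟨isHermitian_gramInf, fun u hu => ?_⟩
    obtain ⟨i, hi⟩ := Function.ne_iff.1 hu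
    have h := integral_norm_sq_feature_pos hx hli hi
    rw [← quadForm_gramInf_eq] at h
    simpa [dotProduct, Matrix.mulVec, Finset.mul_sum, mul_assoc] using h
  have hmem : lam0 x ∈ spectrum ℝ (gramInf x) :=
    (spectrum_gramInf_nonempty hn).csInf_mem Matrix.finite_real_spectrum
  rw [hpd.1.spectrum_real_eq_range_eigenvalues] at hmem
  obtain ⟨k, hk⟩ := hmem
  rw [← hk]
  exact hpd.eigenvalues_pos k

lemma lam0_le_one (hn : 0 < n) (hx : ∀ i, ‖x i‖ = 1) : lam0 x ≤ 1 := by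
  let i : Fin n := ⟨0, hn⟩
  have h1 := (quadForm_gramInf_bounds (x := x) (EuclideanSpace.single i 1)).1
  have h2 : gramInf x i i ≤ 1 := by
    have h3 : ∀ w : Vec d, (if 0 ≤ (inner ℝ w (x i) : ℝ) ∧ 0 ≤ (inner ℝ w (x i) : ℝ) then
        (inner ℝ (x i) (x i) : ℝ) else 0) ≤ 1 := fun w => by
      split_ifs
      · rw [real_inner_self_eq_norm_sq, hx]; norm_num
      · exact zero_le_one
    calc gramInf x i i ≤ ∫ _w : Vec d, (1 : ℝ) ∂(stdGaussian (Vec d)) :=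
          integral_mono (integrable_indicator_pair _ _ _) (integrable_const _) h3
      _ = 1 := by simp
  simp at h1
  linarith

end Positivity

lemma rhoNAG_gt {α : ℝ} (h0 : 0 < α) : 2 - √2 < rhoNAG α := by
  have h2 : √2 ^ 2 = 2 := Real.sq_sqrt (by norm_num)
  have h3 : 7 / 5 < √2 := by
    rw [Real.lt_sqrt (by norm_num)]; norm_num
  have h4 : √(8 + 16 * α + α ^ 2) < 3 * α + 2 * √2 := by
    rw [Real.sqrt_lt' (by positivity)]
    nlinarith
  unfold rhoNAG
  linarith

/-- The exponent of the statement never exceeds the rate `3/4` of the energy estimate. -/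
lemma rhoNAG_le {α : ℝ} (h0 : 0 ≤ α) (h1 : α ≤ 1 / 2) : rhoNAG α ≤ 3 / 4 := by
  have h4 : 5 / 2 + 3 * α ≤ √(8 + 16 * α + α ^ 2) := by
    apply Real.le_sqrt_of_sq_le
    nlinarith
  unfold rhoNAG
  linarith

/-! ### The random initialization -/

section Probability

variable {n d m : ℕ} {x : Fin n → Vec d} {y : Fin n → ℝ}

/-- Markov's inequality for a real function. -/
lemma measure_lt_le_of_lintegral_le {Ω : Type*} [MeasurableSpace Ω] {P : Measure Ω} {f : Ω → ℝ}
    (hf : Measurable f) {M c : ℝ} (hc : 0 < c)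
    (hM : ∫⁻ ω, ENNReal.ofReal (f ω) ∂P ≤ ENNReal.ofReal M) :
    P {ω | c < f ω} ≤ ENNReal.ofReal (M / c) := by
  have h1 := meas_ge_le_lintegral_div (μ := P) (f := fun ω => ENNReal.ofReal (f ω))
    (hf.ennreal_ofReal.aemeasurable) (ε := ENNReal.ofReal c) (by simpa using hc)
    ENNReal.ofReal_ne_top
  refine (measure_mono fun ω hω => ?_).trans (h1.trans ?_)
  · exact ENNReal.ofReal_le_ofReal (le_of_lt hω)
  · rw [ENNReal.ofReal_div_of_pos hc]
    exact ENNReal.div_le_div_right hM _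

lemma ae_abs_signLaw : ∀ᵐ t ∂signLaw, |t| = 1 := by
  simp [signLaw, ae_add_measure_iff, ae_dirac_eq]

lemma integral_id_signLaw : ∫ t, t ∂signLaw = 0 := by
  rw [signLaw, integral_add_measure, integral_smul_measure, integral_smul_measure]
  · simp
  · exact (integrable_dirac (by simp)).smul_measure (by simp)
  · exact (integrable_dirac (by simp)).smul_measure (by simp)

lemma memLp_id_signLaw : MemLp (fun t : ℝ => t) 2 signLaw :=
  MemLp.of_bound measurable_id.aestronglyMeasurable 1
    (ae_abs_signLaw.mono fun t ht => by rw [Real.norm_eq_abs, ht])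

lemma variance_signLaw : Var[fun t : ℝ => t; signLaw] = 1 := by
  rw [variance_eq_sub memLp_id_signLaw, integral_id_signLaw]
  have : ∫ t, ((fun t : ℝ => t) ^ 2) t ∂signLaw = ∫ _t, (1 : ℝ) ∂signLaw :=
    integral_congr_ae (ae_abs_signLaw.mono fun t ht => by simp [← sq_abs t, ht])
  rw [this]; simp

/-- Second moment of a random-sign sum: bias and variance add up. -/
lemma lintegral_sign_sum_sq (c : Fin m → ℝ) (b : ℝ) :
    ∫⁻ a, ENNReal.ofReal ((∑ r, c r * a r - b) ^ 2) ∂(Measure.pi fun _ : Fin m => signLaw) =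
      ENNReal.ofReal (∑ r, c r ^ 2 + b ^ 2) := by
  set ν := Measure.pi fun _ : Fin m => signLaw
  have hmem : ∀ r, MemLp (fun t : ℝ => c r * t) 2 signLaw := fun r => memLp_id_signLaw.const_mul _
  have hmem' : ∀ r, MemLp (fun a : Fin m → ℝ => c r * a r) 2 ν := fun r =>
    (hmem r).comp_measurePreserving (measurePreserving_eval (fun _ : Fin m => signLaw) r)
  have hS : MemLp (fun a : Fin m → ℝ => ∑ r, c r * a r) 2 ν := memLp_finsetSum _ fun r _ => hmem' r
  have hvar : Var[fun a : Fin m → ℝ => ∑ r, c r * a r; ν] = ∑ r, c r ^ 2 := by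
    have h1 := variance_sum_pi (μ := fun _ : Fin m => signLaw) hmem
    have h2 : (∑ r, fun a : Fin m → ℝ => c r * a r) = fun a : Fin m → ℝ => ∑ r, c r * a r := by
      ext a; simp
    rw [h2] at h1
    rw [h1]
    exact Finset.sum_congr rfl fun r _ => by rw [variance_const_mul, variance_signLaw, mul_one]
  have hmean : ∫ a : Fin m → ℝ, ∑ r, c r * a r ∂ν = 0 := by
    rw [integral_finsetSum _ fun r _ => (hmem' r).integrable (by norm_num)]
    refine Finset.sum_eq_zero fun r _ => ?_
    rw [integral_const_mul, integral_comp_eval (μ := fun _ : Fin m => signLaw) (f := fun t => t)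
      measurable_id.aestronglyMeasurable, integral_id_signLaw, mul_zero]
  have hSb : MemLp (fun a : Fin m → ℝ => ∑ r, c r * a r - b) 2 ν := hS.sub (memLp_const b)
  rw [← ofReal_integral_eq_lintegral_ofReal hSb.integrable_sq
    (Filter.Eventually.of_forall fun a => sq_nonneg _)]
  congr 1
  have h3 := variance_eq_sub hSb
  rw [variance_sub_const hS.1, hvar, integral_sub (hS.integrable (by norm_num))
    (integrable_const b), hmean] at h3
  simp only [integral_const, probReal_univ, smul_eq_mul, one_mul, zero_sub, Pi.pow_apply,
    neg_sq] at h3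
  linarith

lemma map_inner_stdGaussian {z : Vec d} (hz : ‖z‖ = 1) :
    (stdGaussian (Vec d)).map (fun w => (inner ℝ w z : ℝ)) = gaussianReal 0 1 := by
  have h1 : (fun w : Vec d => (inner ℝ w z : ℝ)) = innerSL ℝ z := by
    ext w; simp [real_inner_comm]
  rw [h1, IsGaussian.map_eq_gaussianReal, integral_strongDual_stdGaussian,
    variance_dual_stdGaussian, innerSL_apply_norm, hz]
  simp

lemma lintegral_inner_sq {z : Vec d} (hz : ‖z‖ = 1) :
    ∫⁻ w : Vec d, ENNReal.ofReal ((inner ℝ w z : ℝ) ^ 2) ∂(stdGaussian (Vec d)) = 1 := by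
  have h1 : ∫⁻ t : ℝ, ENNReal.ofReal (t ^ 2) ∂(gaussianReal 0 1) = 1 := by
    have hmem : MemLp (fun t : ℝ => t) 2 (gaussianReal 0 1) := IsGaussian.memLp_two_id
    rw [← ofReal_integral_eq_lintegral_ofReal hmem.integrable_sq
      (Filter.Eventually.of_forall fun a => sq_nonneg _)]
    have h2 := variance_eq_sub hmem
    simp only [variance_fun_id_gaussianReal, integral_id_gaussianReal] at h2
    simp only [Pi.pow_apply, NNReal.coe_one] at h2
    rw [show ∫ t : ℝ, t ^ 2 ∂(gaussianReal 0 1) = 1 by linarith]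
    simp
  rw [← map_inner_stdGaussian hz, lintegral_map (by fun_prop) (by fun_prop)] at h1
  exact h1

/-- Anti-concentration: the standard Gaussian density is at most `1/2`. -/
lemma stdGaussian_abs_inner_le {z : Vec d} (hz : ‖z‖ = 1) (R : ℝ) :
    stdGaussian (Vec d) {w | |(inner ℝ w z : ℝ)| ≤ R} ≤ ENNReal.ofReal R := by
  have h1 : {w : Vec d | |(inner ℝ w z : ℝ)| ≤ R} =
      (fun w => (inner ℝ w z : ℝ)) ⁻¹' Set.Icc (-R) R := by
    ext w; simp [abs_le]
  rw [h1, ← Measure.map_apply (by fun_prop) measurableSet_Icc, map_inner_stdGaussian hz,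
    gaussianReal_apply _ one_ne_zero]
  have h2 : ∀ t, gaussianPDF 0 1 t ≤ ENNReal.ofReal (1 / 2) := fun t => by
    rw [gaussianPDF_def, gaussianPDFReal_def]
    refine ENNReal.ofReal_le_ofReal ?_
    have h3 : (2 : ℝ) ≤ √(2 * Real.pi * (1 : NNReal)) := by
      refine Real.le_sqrt_of_sq_le ?_
      have := Real.pi_gt_three
      simp only [NNReal.coe_one]
      linarith
    have h4 : Real.exp (-(t - 0) ^ 2 / (2 * ((1 : NNReal) : ℝ))) ≤ 1 :=
      Real.exp_le_one_iff.2 (div_nonpos_of_nonpos_of_nonneg (neg_nonpos.2 (sq_nonneg _))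
        (by positivity))
    refine (mul_le_mul (inv_anti₀ two_pos h3) h4 (Real.exp_pos _).le (by norm_num)).trans_eq ?_
    norm_num
  calc _ ≤ ∫⁻ _t in Set.Icc (-R) R, ENNReal.ofReal (1 / 2) := lintegral_mono h2
    _ = ENNReal.ofReal (1 / 2) * ENNReal.ofReal (R - -R) := by
      rw [lintegral_const, Measure.restrict_apply_univ, Real.volume_Icc]
    _ = ENNReal.ofReal R := by
      rw [← ENNReal.ofReal_mul (by norm_num)]; congr 1; ring

/-- Law of the hidden weights. -/
noncomputable abbrev weightLaw (m d : ℕ) : Measure (Weights m d) :=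
  Measure.pi fun _ : Fin m => stdGaussian (Vec d)

lemma lintegral_eval_weightLaw {f : Vec d → ℝ≥0∞} (hf : Measurable f) (r : Fin m) :
    ∫⁻ w, f (w r) ∂(weightLaw m d) = ∫⁻ v, f v ∂(stdGaussian (Vec d)) :=
  (measurePreserving_eval (fun _ : Fin m => stdGaussian (Vec d)) r).lintegral_comp hf

lemma measurable_net (z : Vec d) :
    Measurable fun ω : Weights m d × (Fin m → ℝ) => net ω.2 ω.1 z := by
  unfold net
  fun_prop

/-- The signs decorrelate the neurons, so that each output has variance at most `1`. -/
lemma lintegral_residual_sq_le (hm : 0 < m) (hx : ∀ i, ‖x i‖ = 1) (i : Fin n) :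
    ∫⁻ ω, ENNReal.ofReal (residual x y ω.2 ω.1 i ^ 2) ∂(initLaw m d) ≤
      ENNReal.ofReal (1 + y i ^ 2) := by
  have hm' : (0 : ℝ) < m := by exact_mod_cast hm
  have hmeas : Measurable fun ω : Weights m d × (Fin m → ℝ) => residual x y ω.2 ω.1 i :=
    (measurable_net (x i)).sub measurable_const
  rw [initLaw, lintegral_prod _ ((hmeas.pow_const 2).ennreal_ofReal.aemeasurable)]
  have h1 : ∀ w : Weights m d, ∫⁻ a, ENNReal.ofReal (residual x y a w i ^ 2)
      ∂(Measure.pi fun _ : Fin m => signLaw) ≤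
      (∑ r, ENNReal.ofReal (1 / m) * ENNReal.ofReal ((inner ℝ (w r) (x i) : ℝ) ^ 2))
        + ENNReal.ofReal (y i ^ 2) := fun w => by
    have h2 : ∀ a : Fin m → ℝ, residual x y a w i =
        ∑ r, (1 / √(m : ℝ) * max (inner ℝ (w r) (x i) : ℝ) 0) * a r - y i := fun a => by
      rw [residual, net, Finset.mul_sum]
      congr 1
      exact Finset.sum_congr rfl fun r _ => by ring
    simp only [h2]
    rw [lintegral_sign_sum_sq, ENNReal.ofReal_add (Finset.sum_nonneg fun r _ => sq_nonneg _)
      (sq_nonneg _), ENNReal.ofReal_sum_of_nonneg fun r _ => sq_nonneg _]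
    gcongr with r
    rw [← ENNReal.ofReal_mul (by positivity)]
    refine ENNReal.ofReal_le_ofReal ?_
    rw [mul_pow, sq (1 / √(m : ℝ)), inv_sqrt_mul_inv_sqrt]
    refine mul_le_mul_of_nonneg_left ?_ (by positivity)
    rcases max_cases (inner ℝ (w r) (x i) : ℝ) 0 with h | h
    · rw [h.1]
    · rw [h.1, zero_pow two_ne_zero]; exact sq_nonneg _
  have hmeas2 : ∀ z : Vec d, Measurable fun v : Vec d => ENNReal.ofReal ((inner ℝ v z : ℝ) ^ 2) :=
    fun z => by fun_prop
  refine (lintegral_mono h1).trans ?_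
  rw [lintegral_add_right _ measurable_const, lintegral_finsetSum _ fun r _ => by fun_prop]
  have h3 : ∀ r : Fin m, ∫⁻ w : Weights m d, ENNReal.ofReal (1 / m) *
      ENNReal.ofReal ((inner ℝ (w r) (x i) : ℝ) ^ 2) ∂(weightLaw m d) = ENNReal.ofReal (1 / m) :=
    fun r => by
    rw [lintegral_const_mul _ (by fun_prop), lintegral_eval_weightLaw (hmeas2 (x i)),
      lintegral_inner_sq (hx i), mul_one]
  rw [Finset.sum_congr rfl fun r _ => h3 r]
  simp only [Finset.sum_const, Finset.card_univ, Fintype.card_fin, lintegral_const, measure_univ,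
    mul_one, nsmul_eq_mul]
  rw [ENNReal.ofReal_add zero_le_one (sq_nonneg _), ← ENNReal.ofReal_natCast m,
    ← ENNReal.ofReal_mul hm'.le, mul_one_div_cancel hm'.ne']

lemma measurable_nearInd (R : ℝ) (i : Fin n) (r : Fin m) :
    Measurable fun w : Weights m d => nearInd x R w i r := by
  unfold nearInd
  exact Measurable.ite (measurableSet_le (by fun_prop) measurable_const) measurable_const
    measurable_const

lemma measurable_nearFrac (R : ℝ) : Measurable fun w : Weights m d => nearFrac x R w := by
  unfold nearFrac
  exact Finset.measurable_sum _ fun i _ => Finset.measurable_sum _ fun r _ =>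
    (measurable_nearInd R i r).div_const _

lemma lintegral_nearFrac_le (hm : 0 < m) (hx : ∀ i, ‖x i‖ = 1) (R : ℝ) :
    ∫⁻ w, ENNReal.ofReal (nearFrac x R w) ∂(weightLaw m d) ≤ ENNReal.ofReal (n * R) := by
  have hm' : (0 : ℝ) < m := by exact_mod_cast hm
  have h1 : ∀ w : Weights m d, ENNReal.ofReal (nearFrac x R w) =
      ∑ i, ∑ r, ENNReal.ofReal (nearInd x R w i r / m) := fun w => by
    rw [nearFrac, ENNReal.ofReal_sum_of_nonneg fun i _ => Finset.sum_nonneg fun r _ =>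
      div_nonneg (nearInd_nonneg i r) hm'.le]
    exact Finset.sum_congr rfl fun i _ => ENNReal.ofReal_sum_of_nonneg fun r _ =>
      div_nonneg (nearInd_nonneg i r) hm'.le
  have h2 : ∀ (i : Fin n) (r : Fin m), ∫⁻ w : Weights m d, ENNReal.ofReal (nearInd x R w i r / m)
      ∂(weightLaw m d) ≤ ENNReal.ofReal (R / m) := fun i r => by
    have h3 : ∀ w : Weights m d, ENNReal.ofReal (nearInd x R w i r / m) = ENNReal.ofReal (1 / m) *
        {v : Vec d | |(inner ℝ v (x i) : ℝ)| ≤ R}.indicator 1 (w r) := fun w => by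
      unfold nearInd
      by_cases h : |(inner ℝ (w r) (x i) : ℝ)| ≤ R <;> simp [h]
    have hms : MeasurableSet {v : Vec d | |(inner ℝ v (x i) : ℝ)| ≤ R} :=
      measurableSet_le (by fun_prop) measurable_const
    simp only [h3]
    rw [lintegral_eval_weightLaw (m := m) (f := fun v => ENNReal.ofReal (1 / m) *
        {v : Vec d | |(inner ℝ v (x i) : ℝ)| ≤ R}.indicator 1 v)
        ((measurable_one.indicator hms).const_mul _),
      lintegral_const_mul _ (measurable_one.indicator hms), lintegral_indicator_one hms]
    calc _ ≤ ENNReal.ofReal (1 / m) * ENNReal.ofReal R := by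
          gcongr; exact stdGaussian_abs_inner_le (hx i) R
      _ = _ := by rw [← ENNReal.ofReal_mul (by positivity)]; congr 1; ring
  simp only [h1]
  have hmeas : ∀ i r, Measurable fun w : Weights m d => ENNReal.ofReal (nearInd x R w i r / m) :=
    fun i r => ((measurable_nearInd R i r).div_const _).ennreal_ofReal
  rw [lintegral_finsetSum _ fun i _ => Finset.measurable_sum _ fun r _ => hmeas i r]
  calc _ ≤ ∑ _i : Fin n, ∑ _r : Fin m, ENNReal.ofReal (R / m) := Finset.sum_le_sum fun i _ => by
        rw [lintegral_finsetSum _ fun r _ => hmeas i r]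
        exact Finset.sum_le_sum fun r _ => h2 i r
    _ = ENNReal.ofReal (n * R) := by
      simp only [Finset.sum_const, Finset.card_univ, Fintype.card_fin, nsmul_eq_mul]
      rw [← ENNReal.ofReal_natCast m, ← ENNReal.ofReal_natCast n, ← ENNReal.ofReal_mul hm'.le,
        ← ENNReal.ofReal_mul (Nat.cast_nonneg n), mul_div_cancel₀ _ hm'.ne']

/-- Gram entries of the activation patterns, without the output signs. -/
noncomputable def gramW (x : Fin n → Vec d) (w : Weights m d) (i j : Fin n) : ℝ :=
  ∑ r, 1 / m * (if 0 ≤ (inner ℝ (w r) (x i) : ℝ) ∧ 0 ≤ (inner ℝ (w r) (x j) : ℝ) then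
    (inner ℝ (x i) (x j) : ℝ) else 0)

lemma gram_eq_gramW {a : Fin m → ℝ} (ha : ∀ r, |a r| = 1) (w : Weights m d) (i j : Fin n) :
    gram x a w i j = gramW x w i j := by
  simp only [gram, Matrix.of_apply, gramW]
  refine Finset.sum_congr rfl fun r _ => ?_
  have h : a r / √(m : ℝ) * (a r / √(m : ℝ)) = 1 / m := by
    rw [div_mul_div_comm, ← sq, ← sq_abs, ha, one_pow, Real.mul_self_sqrt (Nat.cast_nonneg m)]
  unfold outGrad
  by_cases hi : 0 ≤ (inner ℝ (w r) (x i) : ℝ) <;> by_cases hj : 0 ≤ (inner ℝ (w r) (x j) : ℝ) <;>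
    simp only [hi, hj, if_true, if_false, and_true, and_false, inner_zero_left, inner_zero_right,
      mul_zero]
  rw [inner_smul_left, inner_smul_right, ← h]
  simp only [conj_trivial]
  ring

lemma measurable_indicator_pair (z z' : Vec d) (c : ℝ) :
    Measurable fun w : Vec d =>
      if 0 ≤ (inner ℝ w z : ℝ) ∧ 0 ≤ (inner ℝ w z' : ℝ) then c else 0 :=
  Measurable.ite ((measurableSet_halfspace z).inter (measurableSet_halfspace z'))
    measurable_const measurable_const

lemma measurable_gramW (i j : Fin n) : Measurable fun w : Weights m d => gramW x w i j := by
  unfold gramW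
  exact Finset.measurable_sum _ fun r _ =>
    ((measurable_indicator_pair _ _ _).comp (measurable_pi_apply r)).const_mul _

/-- Every entry of the initial Gram matrix is an average of `m` independent variables bounded by
`1`, with mean the entry of the limiting kernel. -/
lemma lintegral_gramW_sub_sq_le (hm : 0 < m) (hx : ∀ i, ‖x i‖ = 1) (i j : Fin n) :
    ∫⁻ w, ENNReal.ofReal ((gramW x w i j - gramInf x i j) ^ 2) ∂(weightLaw m d) ≤
      ENNReal.ofReal (1 / m) := by
  have hm' : (0 : ℝ) < m := by exact_mod_cast hm
  set f : Vec d → ℝ := fun w => if 0 ≤ (inner ℝ w (x i) : ℝ) ∧ 0 ≤ (inner ℝ w (x j) : ℝ) then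
    (inner ℝ (x i) (x j) : ℝ) else 0 with hf
  have hfm : Measurable f := measurable_indicator_pair _ _ _
  have hf1 : ∀ w, |f w| ≤ 1 := fun w => by
    simp only [hf]
    split_ifs
    · refine (abs_real_inner_le_norm _ _).trans ?_
      rw [hx, hx]; norm_num
    · simp
  have hmem : MemLp (fun v => 1 / (m : ℝ) * f v) 2 (stdGaussian (Vec d)) :=
    (MemLp.of_bound hfm.aestronglyMeasurable 1 (Filter.Eventually.of_forall hf1)).const_mul _
  have hmem' : ∀ r : Fin m, MemLp (fun w : Weights m d => 1 / (m : ℝ) * f (w r)) 2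
      (weightLaw m d) := fun r => hmem.comp_measurePreserving
        (measurePreserving_eval (fun _ : Fin m => stdGaussian (Vec d)) r)
  have hS : MemLp (fun w : Weights m d => gramW x w i j) 2 (weightLaw m d) :=
    memLp_finsetSum _ fun r _ => hmem' r
  have hmean : ∫ w, gramW x w i j ∂(weightLaw m d) = gramInf x i j := by
    change ∫ w : Weights m d, ∑ r, 1 / (m : ℝ) * f (w r) ∂(weightLaw m d) = _
    rw [integral_finsetSum _ fun r _ => (hmem' r).integrable (by norm_num)]
    have h1 : ∀ r : Fin m, ∫ w : Weights m d, 1 / (m : ℝ) * f (w r) ∂(weightLaw m d) =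
        1 / m * gramInf x i j := fun r => by
      rw [integral_const_mul, integral_comp_eval (μ := fun _ : Fin m => stdGaussian (Vec d))
        hfm.aestronglyMeasurable]
      rfl
    rw [Finset.sum_congr rfl fun r _ => h1 r]
    simp [hm'.ne']
  have hvar1 : Var[fun v => 1 / (m : ℝ) * f v; stdGaussian (Vec d)] ≤ 1 / (m : ℝ) * (1 / m) := by
    rw [variance_const_mul, ← sq]
    have h1 : Var[f; stdGaussian (Vec d)] ≤ 1 := by
      refine (variance_le_expectation_sq hfm.aestronglyMeasurable).trans ?_
      calc _ ≤ ∫ _v : Vec d, (1 : ℝ) ∂(stdGaussian (Vec d)) := by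
            refine integral_mono (MemLp.of_bound (p := 2) hfm.aestronglyMeasurable 1
              (Filter.Eventually.of_forall hf1)).integrable_sq (integrable_const _) fun v => ?_
            exact (sq_le_one_iff_abs_le_one _).2 (hf1 v)
        _ = 1 := by simp
    exact mul_le_of_le_one_right (sq_nonneg _) h1
  have hvar : Var[fun w : Weights m d => gramW x w i j; weightLaw m d] ≤ 1 / m := by
    have h1 := variance_sum_pi (μ := fun _ : Fin m => stdGaussian (Vec d)) fun _ : Fin m => hmem
    have h2 : (∑ r, fun w : Weights m d => 1 / (m : ℝ) * f (w r)) =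
        fun w : Weights m d => gramW x w i j := by
      ext w; simp only [Finset.sum_apply]; rfl
    rw [h2] at h1
    calc _ = _ := h1
      _ ≤ ∑ _r : Fin m, 1 / (m : ℝ) * (1 / m) := Finset.sum_le_sum fun r _ => hvar1
      _ = 1 / m := by simp [hm'.ne']
  rw [variance_eq_integral hS.1.aemeasurable, hmean] at hvar
  have hint : Integrable (fun w => (gramW x w i j - gramInf x i j) ^ 2) (weightLaw m d) :=
    (hS.sub (memLp_const (gramInf x i j))).integrable_sq
  rw [← ofReal_integral_eq_lintegral_ofReal hint (Filter.Eventually.of_forall fun a => sq_nonneg _)]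
  exact ENNReal.ofReal_le_ofReal hvar

end Probability

/-! ### The width condition -/

section Width

variable {n d m : ℕ} {x : Fin n → Vec d} {y : Fin n → ℝ}

/-- By Markov's inequality, with probability at least `1 - δ` the three random quantities that
govern the dynamics are at most `3/δ` times the bounds on their means. -/
lemma exists_good_event (hn : 0 < n) (hm : 0 < m) (hx : ∀ i, ‖x i‖ = 1) {B δ R : ℝ}
    (hB : ∀ i, |y i| ≤ B) (hδ : 0 < δ) (hR : 0 < R) :
    ∃ G : Set (Weights m d × (Fin m → ℝ)), MeasurableSet G ∧
      ENNReal.ofReal (1 - δ) ≤ initLaw m d G ∧ ∀ ω ∈ G, (∀ r, |ω.2 r| = 1) ∧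
        ∑ i, residual x y ω.2 ω.1 i ^ 2 ≤ 3 * n * (1 + B ^ 2) / δ ∧
        nearFrac x R ω.1 ≤ 3 * n * R / δ ∧
        ∑ i, ∑ j, (gram x ω.2 ω.1 i j - gramInf x i j) ^ 2 ≤ 3 * n ^ 2 / (m * δ) := by
  have hn' : (0 : ℝ) < n := by exact_mod_cast hn
  have hm' : (0 : ℝ) < m := by exact_mod_cast hm
  set P := initLaw m d
  have hfst : MeasurePreserving (Prod.fst : Weights m d × (Fin m → ℝ) → Weights m d) P
      (weightLaw m d) := measurePreserving_fst
  let f₁ : Weights m d × (Fin m → ℝ) → ℝ := fun ω => ∑ i, residual x y ω.2 ω.1 i ^ 2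
  let f₂ : Weights m d × (Fin m → ℝ) → ℝ := fun ω => nearFrac x R ω.1
  let f₃ : Weights m d × (Fin m → ℝ) → ℝ := fun ω => ∑ i, ∑ j, (gramW x ω.1 i j - gramInf x i j) ^ 2
  have hres : ∀ i, Measurable fun ω : Weights m d × (Fin m → ℝ) => residual x y ω.2 ω.1 i ^ 2 :=
    fun i => ((measurable_net (x i)).sub measurable_const).pow_const 2
  have hgr : ∀ i j, Measurable fun w : Weights m d => (gramW x w i j - gramInf x i j) ^ 2 :=
    fun i j => ((measurable_gramW i j).sub measurable_const).pow_const 2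
  have hf₁ : Measurable f₁ := Finset.measurable_sum _ fun i _ => hres i
  have hf₂ : Measurable f₂ := (measurable_nearFrac R).comp measurable_fst
  have hf₃ : Measurable f₃ := Finset.measurable_sum _ fun i _ => Finset.measurable_sum _ fun j _ =>
    (hgr i j).comp measurable_fst
  have h₁ : P {ω | 3 * n * (1 + B ^ 2) / δ < f₁ ω} ≤ ENNReal.ofReal (δ / 3) := by
    refine (measure_lt_le_of_lintegral_le hf₁ (M := n * (1 + B ^ 2)) (by positivity) ?_).trans_eq ?_
    · calc _ = ∑ i, ∫⁻ ω, ENNReal.ofReal (residual x y ω.2 ω.1 i ^ 2) ∂P := by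
            rw [← lintegral_finsetSum _ fun i _ => (hres i).ennreal_ofReal]
            exact lintegral_congr fun ω => ENNReal.ofReal_sum_of_nonneg fun i _ => sq_nonneg _
        _ ≤ ∑ _i : Fin n, ENNReal.ofReal (1 + B ^ 2) := Finset.sum_le_sum fun i _ =>
            (lintegral_residual_sq_le hm hx i).trans (ENNReal.ofReal_le_ofReal (by
              rw [← sq_abs (y i)]
              have := pow_le_pow_left₀ (abs_nonneg (y i)) (hB i) 2
              linarith))
        _ = _ := by
            simp only [Finset.sum_const, Finset.card_univ, Fintype.card_fin, nsmul_eq_mul]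
            rw [← ENNReal.ofReal_natCast n, ← ENNReal.ofReal_mul hn'.le]
    · congr 1; field_simp
  have h₂ : P {ω | 3 * n * R / δ < f₂ ω} ≤ ENNReal.ofReal (δ / 3) := by
    refine (measure_lt_le_of_lintegral_le hf₂ (M := n * R) (by positivity) ?_).trans_eq ?_
    · rw [hfst.lintegral_comp (f := fun w => ENNReal.ofReal (nearFrac x R w))
        (measurable_nearFrac R).ennreal_ofReal]
      exact lintegral_nearFrac_le hm hx R
    · congr 1; field_simp
  have h₃ : P {ω | 3 * n ^ 2 / (m * δ) < f₃ ω} ≤ ENNReal.ofReal (δ / 3) := by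
    refine (measure_lt_le_of_lintegral_le hf₃ (M := n ^ 2 / m) (by positivity) ?_).trans_eq ?_
    · rw [hfst.lintegral_comp
        (f := fun w => ENNReal.ofReal (∑ i, ∑ j, (gramW x w i j - gramInf x i j) ^ 2))
        (Finset.measurable_sum _ fun i _ => Finset.measurable_sum _ fun j _ => hgr i j).ennreal_ofReal]
      calc _ = ∑ i, ∑ j, ∫⁻ w, ENNReal.ofReal ((gramW x w i j - gramInf x i j) ^ 2)
              ∂(weightLaw m d) := by
            simp only [← lintegral_finsetSum _ fun j _ => (hgr _ j).ennreal_ofReal]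
            rw [← lintegral_finsetSum _ fun i _ => Finset.measurable_sum _ fun j _ =>
              (hgr i j).ennreal_ofReal]
            refine lintegral_congr fun w => ?_
            rw [ENNReal.ofReal_sum_of_nonneg fun i _ => Finset.sum_nonneg fun j _ => sq_nonneg _]
            exact Finset.sum_congr rfl fun i _ =>
              ENNReal.ofReal_sum_of_nonneg fun j _ => sq_nonneg _
        _ ≤ ∑ _i : Fin n, ∑ _j : Fin n, ENNReal.ofReal (1 / m) := Finset.sum_le_sum fun i _ =>
            Finset.sum_le_sum fun j _ => lintegral_gramW_sub_sq_le hm hx i j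
        _ = _ := by
            simp only [Finset.sum_const, Finset.card_univ, Fintype.card_fin, nsmul_eq_mul]
            rw [← ENNReal.ofReal_natCast n, ← ENNReal.ofReal_mul hn'.le,
              ← ENNReal.ofReal_mul hn'.le]
            congr 1; ring
    · congr 1; field_simp
  let S : Set (Weights m d × (Fin m → ℝ)) := {ω | ∀ r, |ω.2 r| = 1}
  have hS : MeasurableSet S := by
    rw [show S = ⋂ r, {ω | |ω.2 r| = 1} by ext; simp [S]]
    exact MeasurableSet.iInter fun r => measurableSet_eq_fun (by fun_prop) measurable_const
  have h₀ : P Sᶜ = 0 := by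
    have h1 : ∀ᵐ a ∂(Measure.pi fun _ : Fin m => signLaw), ∀ r, |a r| = 1 :=
      ae_all_iff.2 fun r =>
        (Measure.quasiMeasurePreserving_eval (fun _ : Fin m => signLaw) r).ae ae_abs_signLaw
    exact Measure.quasiMeasurePreserving_snd.ae h1
  refine ⟨S ∩ {ω | f₁ ω ≤ 3 * n * (1 + B ^ 2) / δ} ∩ {ω | f₂ ω ≤ 3 * n * R / δ} ∩
    {ω | f₃ ω ≤ 3 * n ^ 2 / (m * δ)}, ?_, ?_, ?_⟩
  · exact ((hS.inter (measurableSet_le hf₁ measurable_const)).inter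
      (measurableSet_le hf₂ measurable_const)).inter (measurableSet_le hf₃ measurable_const)
  · have hcompl : P (S ∩ {ω | f₁ ω ≤ 3 * n * (1 + B ^ 2) / δ} ∩ {ω | f₂ ω ≤ 3 * n * R / δ} ∩
        {ω | f₃ ω ≤ 3 * n ^ 2 / (m * δ)})ᶜ ≤ ENNReal.ofReal δ := by
      rw [Set.compl_inter, Set.compl_inter, Set.compl_inter]
      refine (measure_union_le _ _).trans ((add_le_add_left ((measure_union_le _ _).trans
        (add_le_add_left (measure_union_le _ _) _)) _).trans ?_)
      simp only [Set.compl_ofPred, not_le, h₀, zero_add]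
      refine (add_le_add (add_le_add h₁ h₂) h₃).trans_eq ?_
      rw [← ENNReal.ofReal_add (by positivity) (by positivity),
        ← ENNReal.ofReal_add (by positivity) (by positivity)]
      congr 1; ring
    rw [ENNReal.ofReal_sub _ hδ.le, ENNReal.ofReal_one, tsub_le_iff_right,
      ← measure_univ (μ := P), ← Set.union_compl_self (S ∩ {ω | f₁ ω ≤ 3 * n * (1 + B ^ 2) / δ} ∩
        {ω | f₂ ω ≤ 3 * n * R / δ} ∩ {ω | f₃ ω ≤ 3 * n ^ 2 / (m * δ)})]
    exact (measure_union_le _ _).trans (add_le_add_right hcompl _)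
  · rintro ω ⟨⟨⟨h1, h2⟩, h3⟩, h4⟩
    refine ⟨h1, h2, h3, ?_⟩
    simp only [gram_eq_gramW h1]
    exact h4

/-- The constant `C(B)` of the width condition. It is chosen so that `travelRadius` makes the expected
number of flipped activations small: `42000 = 1500 · 28`, with `28` from the travel radius, `1500`
from `3/δ` in Markov's inequality and `1/500` in `GoodInit.near_le`, and `3 (1 + B²)` from the bound
on the initial residual. -/
noncomputable def widthConst (B : ℝ) : ℝ := 3 * 42000 ^ 2 * (1 + B ^ 2)

/-- Bound on the travel of a neuron on the good event. The factor `28` instead of the `27` of the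
travel estimate makes `GoodInit.travel_lt` strict. -/
noncomputable def travelRadius (x : Fin n → Vec d) (m : ℕ) (B δ : ℝ) : ℝ :=
  28 * √((n : ℝ) / m) * √(3 * n * (1 + B ^ 2) / δ) / lam0 x

lemma goodInit_of_width (hn : 0 < n) (hm : 0 < m) (hx : ∀ i, ‖x i‖ = 1) (hl : 0 < lam0 x)
    {B δ : ℝ} (hδ : 0 < δ) (hδ1 : δ < 1)
    (hC : widthConst B * n ^ 6 ≤ m * (δ ^ 3 * lam0 x ^ 4))
    {a : Fin m → ℝ} {w : Weights m d} (ha : ∀ r, |a r| = 1)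
    (hres : ∑ i, residual x y a w i ^ 2 ≤ 3 * n * (1 + B ^ 2) / δ)
    (hnear : nearFrac x (travelRadius x m B δ) w ≤ 3 * n * travelRadius x m B δ / δ)
    (hgram : ∑ i, ∑ j, (gram x a w i j - gramInf x i j) ^ 2 ≤ 3 * n ^ 2 / (m * δ)) :
    GoodInit x y (travelRadius x m B δ) a w := by
  have hn1 : (1 : ℝ) ≤ n := by exact_mod_cast hn
  have hn' : (0 : ℝ) < n := by linarith
  have hm' : (0 : ℝ) < m := by exact_mod_cast hm
  have hl1 := lam0_le_one hn hx
  set l := lam0 x with hldef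
  have hB0 : 0 ≤ B ^ 2 := sq_nonneg B
  have hC1 : 4000 * (n : ℝ) ^ 6 ≤ m * (δ ^ 3 * l ^ 4) := by
    refine le_trans ?_ hC
    unfold widthConst
    gcongr
    nlinarith
  have hδ3 : δ ^ 3 ≤ 1 := pow_le_one₀ hδ.le hδ1.le
  refine ⟨ha, ?_, ?_, ?_, ?_⟩
  · refine hgram.trans ?_
    rw [div_le_iff₀ (by positivity), ← hldef]
    have h1 : (n : ℝ) ^ 2 ≤ n ^ 6 := pow_le_pow_right₀ hn1 (by norm_num)
    have h2 : δ ^ 3 ≤ δ := by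
      calc δ ^ 3 = δ * δ ^ 2 := by ring
        _ ≤ δ * 1 := by gcongr; exact pow_le_one₀ hδ.le hδ1.le
        _ = δ := mul_one δ
    have h3 : l ^ 4 ≤ l ^ 2 := pow_le_pow_of_le_one hl.le hl1 (by norm_num)
    have h4 : m * (δ ^ 3 * l ^ 4) ≤ m * (δ * l ^ 2) := by gcongr
    nlinarith
  · have hR : 1500 * n ^ 2 * travelRadius x m B δ ≤ δ * l := by
      refine le_of_sq_le_sq ?_ (by positivity)
      unfold travelRadius
      rw [mul_pow, div_pow, mul_pow, mul_pow _ (√(3 * n * (1 + B ^ 2) / δ)),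
        Real.sq_sqrt (by positivity), mul_pow, Real.sq_sqrt (by positivity), ← hldef]
      have h1 : 1500 ^ 2 * ((n : ℝ) ^ 2) ^ 2 * (28 ^ 2 * (n / m) * (3 * n * (1 + B ^ 2) / δ) / l ^ 2) =
          widthConst B * n ^ 6 / (m * δ * l ^ 2) := by
        unfold widthConst
        field_simp
        ring
      rw [h1, div_le_iff₀ (by positivity)]
      refine hC.trans_eq ?_
      ring
    calc n * nearFrac x (travelRadius x m B δ) w ≤ n * (3 * n * travelRadius x m B δ / δ) := by
          gcongr
      _ = (1500 * n ^ 2 * travelRadius x m B δ) / (500 * δ) := by field_simp; ring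
      _ ≤ (δ * l) / (500 * δ) := by gcongr
      _ = l / 500 := by field_simp
  · have h1 : ‖(WithLp.toLp 2 (residual x y a w) : EuclideanSpace ℝ (Fin n))‖ ≤
        √(3 * n * (1 + B ^ 2) / δ) := by
      refine Real.le_sqrt_of_sq_le ?_
      rw [EuclideanSpace.norm_sq_eq]
      simpa using hres
    have h2 : 0 < √((n : ℝ) / m) * √(3 * n * (1 + B ^ 2) / δ) := by positivity
    unfold travelRadius
    rw [← hldef]
    gcongr ?_ / _
    calc _ ≤ 27 * √((n : ℝ) / m) * √(3 * n * (1 + B ^ 2) / δ) := by gcongr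
      _ < _ := by linarith
  · rw [div_le_div_iff₀ hm' (by norm_num)]
    have h1 : (n : ℝ) ≤ n ^ 6 := le_self_pow₀ hn1 (by norm_num)
    have h3 : l ^ 4 ≤ l := pow_le_of_le_one hl.le hl1 (by norm_num)
    have h4 : m * (δ ^ 3 * l ^ 4) ≤ m * (1 * l) := by gcongr
    linarith

end Width

end ReLUNet

theorem theorem2 :
    (∀ B : ℝ, ∃ C : ℝ, 0 < C ∧
      ∀ (n d m : ℕ) (x : Fin n → ReLUNet.Vec d) (y : Fin n → ℝ) (δ s : ℝ),
        0 < n →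
        (∀ i, ‖x i‖ = 1) →
        (∀ i j, i ≠ j → LinearIndependent ℝ ![x i, x j]) →
        (∀ i, |y i| ≤ B) →
        0 < δ → δ < 1 →
        C * ((n : ℝ) ^ 6 / (δ ^ 3 * ReLUNet.lam0 x ^ 4)) ≤ (m : ℝ) →
        0 < s → s ≤ 2 / ReLUNet.lamM x →
        ∃ G : Set (ReLUNet.Weights m d × (Fin m → ℝ)),
          MeasurableSet G ∧ ENNReal.ofReal (1 - δ) ≤ ReLUNet.initLaw m d G ∧
          ∀ ω ∈ G, ∀ (T : ℝ) (W V : ℝ → ReLUNet.Weights m d),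
            (ReLUNet.IsNAGSolution x y ω.2 (ReLUNet.hessBlock x ω.2) s T W V ∨
              ReLUNet.IsNAGSolution x y ω.2 (ReLUNet.hessFull x ω.2) s T W V) →
            W 0 = ω.1 →
            ∀ t ∈ Set.Icc 0 T,
              ReLUNet.loss x y ω.2 (W t) ≤
                26 * ReLUNet.pseudoLoss x y ω.2 (W 0) / (3 * ReLUNet.lam0 x) *
                  Real.exp (-(ReLUNet.rhoNAG (ReLUNet.nagAlpha x s)
                    * √(ReLUNet.lam0 x / 2) * t))) ∧
    (∀ α : ℝ, 0 < α → α ≤ 1 / 2 → 2 - √2 < ReLUNet.rhoNAG α) := by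
  refine ⟨fun B => ⟨ReLUNet.widthConst B, ?_, ?_⟩, fun α h0 _ => ReLUNet.rhoNAG_gt h0⟩
  · unfold ReLUNet.widthConst; positivity
  intro n d m x y δ s hn hx hli hB hδ hδ1 hm hs hsM
  have hl := ReLUNet.lam0_pos hn hx hli
  have hn' : (0 : ℝ) < n := by exact_mod_cast hn
  have hCpos : 0 < ReLUNet.widthConst B := by unfold ReLUNet.widthConst; positivity
  have hm' : (0 : ℝ) < m := lt_of_lt_of_le (by positivity) hm
  have hm0 : 0 < m := by exact_mod_cast hm'
  have hC : ReLUNet.widthConst B * n ^ 6 ≤ m * (δ ^ 3 * ReLUNet.lam0 x ^ 4) := by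
    rwa [← mul_div_assoc, div_le_iff₀ (by positivity)] at hm
  have hM := ReLUNet.lam0_le_lamM (x := x) hn
  have hsM' : s * ReLUNet.lamM x ≤ 2 := by
    rwa [le_div_iff₀ (by linarith)] at hsM
  have hR : 0 < ReLUNet.travelRadius x m B δ := by
    unfold ReLUNet.travelRadius; positivity
  obtain ⟨G, hG, hP, hgood⟩ := ReLUNet.exists_good_event hn hm0 hx hB hδ hR
  refine ⟨G, hG, hP, fun ω hω T W V hsol hW t ht => ?_⟩
  obtain ⟨ha, hres, hnear, hgram⟩ := hgood ω hω
  have hinit := ReLUNet.goodInit_of_width hn hm0 hx hl hδ hδ1 hC ha hres hnear hgram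
  have hloss : ReLUNet.loss x y ω.2 (W t) ≤ 26 * ReLUNet.pseudoLoss x y ω.2 (W 0) /
      (3 * ReLUNet.lam0 x) * Real.exp (-(3 / 4 * √(ReLUNet.lam0 x / 2) * t)) := by
    rcases hsol with h | h
    · exact hinit.loss_le hn hx hl hs hsM' (Or.inl rfl) h hW ht
    · exact hinit.loss_le hn hx hl hs hsM' (Or.inr rfl) h hW ht
  refine hloss.trans ?_
  have hpl : 0 ≤ ReLUNet.pseudoLoss x y ω.2 (W 0) := by
    rw [ReLUNet.pseudoLoss_eq]; positivity
  have hα : ReLUNet.nagAlpha x s ≤ 1 / 2 := by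
    unfold ReLUNet.nagAlpha
    have : √(2 * ReLUNet.lam0 x * s) ≤ 2 := by
      rw [Real.sqrt_le_left two_pos.le]
      nlinarith
    linarith
  have hρ := ReLUNet.rhoNAG_le (α := ReLUNet.nagAlpha x s)
    (by unfold ReLUNet.nagAlpha; positivity) hα
  have ht0 : 0 ≤ t := ht.1
  gcongr
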